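/- **Setting.** For a finite simple graph $G$ let $M_G$ be the group generated by a central element $\mathrm i$ with $\mathrm i^4=1$ (write $-1:=\mathrm i^2$), the vertices $v_j$ and the directed edges $e_{jk}$ of $G$, subject to $e_{jk}^2=v_j^2=1$, $e_{jk}=-e_{kj}$, $v_jv_k=v_kv_j$, $e_{jk}v_l=v_le_{jk}$ for $l\notin\{j,k\}$, $e_{jk}v_k=-v_ke_{jk}$, $e_{jk}e_{kl}=-e_{kl}e_{jk}$ for $j\ne l$, and $e_{jk}e_{lm}=e_{lm}e_{jk}$ for $\{j,k\}\cap\{l,m\}=\emptyset$. Let $\mathcal C_G\le M_G$ be the subgroup generated by the cycles $\mathrm i^{r}e_{j_1j_2}e_{j_2j_3}\cdots e_{j_rj_1}$ of all closed walks in $G$ with $r$ edges. Let $G$ be the cubic lattice with $n_1\times n_2\times n_3$ cells, $n_1,n_2,n_3\ge 1$: its vertices are the integer points of $\prod_k[0,n_k]$, its edges join points at distance $1$. Orient the edges so that in every two-dimensional axis-parallel slice the unit faces are alternately (in a checkerboard pattern) *even* (the four edges circulate around the face) and *odd* (edges of the face that meet at a vertex of it do so head to head or tail to tail). A cell is *odd*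 if all its six faces are odd. An *isolated odd face* is an odd face on the boundary of the lattice that is not a face of an odd cell. For each isolated odd face choose one of its four edges. Put one qubit on every vertex and one on every odd face. For an edge from $j$ to $k$ (in the orientation), in coordinate direction $x$, $y$ or $z$, let $\tilde e_{jk}=\pm X_jY_kP(j,k)$ and $\tilde e_{kj}=-\tilde e_{jk}$, where $P(j,k)$ is the product of the Pauli operators $X$, $Y$ or $Z$, respectively, on the qubits of all odd faces that contain the edge, and where the sign is $-$ if the edge has been chosen for an isolated odd face and $+$ otherwise. Let $\tilde v_j=Z_j$. **Lemma.** There is a (necessarily unique) representation $\sigma$ of $M_G$ on the Hilbert space of the qubits with $\sigma(\mathrm i)=\mathrm i\,\mathbb I$, $\sigma(v_j)=\tilde v_j$ and $\sigma(e_{jk})=\tilde e_{jk}$. Let $K=\ker(\sigma|_{\mathcal C_G})$ be the group of cycles mapped to the identity, and let $D(K)$ be its rank, i.e. the minimum size of a generating set. Then $K$ is finitely generated and $$D(K)=IOF+2\,OC,$$ where $IOF$ is the number of isolated odd faces and $OC$ the number of odd cells. Moreover, however one chooses two different pairs of opposite faces of each odd cell, the cycles around the isolated odd faces together with the products $ab$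 of the cycles $a,b$ around the two faces of each chosen pair generate $K$; these $IOF+2\,OC$ elements are pairwise distinct, and none of them lies in the subgroup generated by the others. -/

import Mathlib

/-! ### The group of edges and vertices of a graph, and its cycle subgroup -/

/-- Generators: the phase `i`, the vertices, and the directed edges `e_{ij}`. -/
inductive MGen {V : Type} (G : SimpleGraph V) : Type
  | phase : MGen G
  | vert (v : V) : MGen G
  | edge (d : G.Dart) : MGen G

namespace MGen

/-- The generator `i`, as a word. -/
def I {V : Type} (G : SimpleGraph V) : FreeGroup (MGen G) := FreeGroup.of phase

/-- A vertex, as a word. -/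
def v {V : Type} (G : SimpleGraph V) (x : V) : FreeGroup (MGen G) := FreeGroup.of (vert x)

/-- A directed edge, as a word. -/
def e {V : Type} (G : SimpleGraph V) (d : G.Dart) : FreeGroup (MGen G) := FreeGroup.of (edge d)

end MGen

open MGen in
/-- `MRel G a b`: the relation `a = b` is one of the defining relations of `M_G`.
The phases `±1, ±i` are the powers of the central element `I G`, so that `-1` is `I G ^ 2`. -/
inductive MRel {V : Type} (G : SimpleGraph V) : FreeGroup (MGen G) → FreeGroup (MGen G) → Prop
  | phase_order : MRel G (I G ^ 4) 1
  | phase_central (x : MGen G) : MRel G (I G * FreeGroup.of x) (FreeGroup.of x * I G)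
  | edge_sq (d : G.Dart) : MRel G (e G d ^ 2) 1
  | vert_sq (x : V) : MRel G (v G x ^ 2) 1
  | edge_symm (d : G.Dart) : MRel G (e G d) (I G ^ 2 * e G d.symm)
  | vert_vert (x y : V) : MRel G (v G x * v G y) (v G y * v G x)
  | edge_vert_comm (d : G.Dart) (x : V) (h₁ : x ≠ d.fst) (h₂ : x ≠ d.snd) :
      MRel G (e G d * v G x) (v G x * e G d)
  | edge_edge_comm (d d' : G.Dart) (h₁ : d.fst ≠ d'.fst) (h₂ : d.fst ≠ d'.snd)
      (h₃ : d.snd ≠ d'.fst) (h₄ : d.snd ≠ d'.snd) : MRel G (e G d * e G d') (e G d' * e G d)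
  | edge_vert_anti (d : G.Dart) : MRel G (e G d * v G d.snd) (I G ^ 2 * (v G d.snd * e G d))
  | edge_edge_anti (d d' : G.Dart) (h : d.snd = d'.fst) (h' : d.fst ≠ d'.snd) :
      MRel G (e G d * e G d') (I G ^ 2 * (e G d' * e G d))

/-- The finitely presented group `M_G`. -/
abbrev MGroup {V : Type} (G : SimpleGraph V) : Type :=
  PresentedGroup {r : FreeGroup (MGen G) | ∃ a b, MRel G a b ∧ r = a * b⁻¹}

namespace MGroup

variable {V : Type} (G : SimpleGraph V)

/-- The phase `i` in `M_G`. -/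
def I : MGroup G := PresentedGroup.of MGen.phase

/-- The element of `M_G` given by a vertex. -/
def vert (x : V) : MGroup G := PresentedGroup.of (MGen.vert x)

/-- The element of `M_G` given by a directed edge. -/
def edge (d : G.Dart) : MGroup G := PresentedGroup.of (MGen.edge d)

/-- The element `i ^ (number of edges) * ∏ e` attached to a walk. -/
def ofWalk {x y : V} (p : G.Walk x y) : MGroup G :=
  I G ^ p.length * (p.darts.map (edge G)).prod

/-- The group of directed cycles `C_G`. -/
def cycles : Subgroup (MGroup G) :=
  Subgroup.closure {a | ∃ (x : V) (p : G.Walk x x), a = ofWalk G p}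

/-- `K = ker (σ|_{C_G})`, the group of all cycles that are mapped to the identity. -/
def cycleKernel {A : Type} [Monoid A] (σ : MGroup G →* A) : Subgroup (MGroup G) :=
  cycles G ⊓ σ.ker

end MGroup

/-! ### Pauli operators on a finite set of qubits -/

namespace Pauli

/-- The Pauli matrices `X`, `Y`, `Z`, indexed by `0`, `1`, `2`. -/
def mat : Fin 3 → Matrix (Fin 2) (Fin 2) ℂ :=
  ![!![0, 1; 1, 0], !![0, -Complex.I; Complex.I, 0], !![1, 0; 0, -1]]

/-- The operator `⨂_q P_q` on the Hilbert space `⨂_q ℂ²`, as a matrix in the computational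
basis. -/
def tensor {Q : Type} [Fintype Q] (P : Q → Matrix (Fin 2) (Fin 2) ℂ) :
    Matrix (Q → Fin 2) (Q → Fin 2) ℂ :=
  Matrix.of fun a b => ∏ q, P q (a q) (b q)

end Pauli

/-! ### The cubic lattice with `n 0 × n 1 × n 2` cells -/

namespace Cubic

/-- Vertices of the lattice: integer points of the box `∏ [0, n k]`. -/
abbrev Vertex (n : Fin 3 → ℕ) : Type := (k : Fin 3) → Fin (n k + 1)

variable {n : Fin 3 → ℕ}

/-- `w` is the neighbour of `v` in the positive `k`-direction. -/
def IsNext (k : Fin 3) (v w : Vertex n) : Prop :=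
  (w k : ℕ) = v k + 1 ∧ ∀ l, l ≠ k → w l = v l

instance (k : Fin 3) (v w : Vertex n) : Decidable (IsNext k v w) :=
  inferInstanceAs (Decidable (_ ∧ _))

/-- The graph of the cubic lattice. -/
def graph (n : Fin 3 → ℕ) : SimpleGraph (Vertex n) where
  Adj v w := ∃ k, IsNext k v w ∨ IsNext k w v
  symm := ⟨fun _ _ ⟨k, h⟩ => ⟨k, h.symm⟩⟩
  loopless := ⟨fun v ⟨k, h⟩ => by
    rcases h with h | h <;> exact absurd h.1 (by omega)⟩

instance : DecidableRel (graph n).Adj := fun v w =>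
  inferInstanceAs (Decidable (∃ k, IsNext k v w ∨ IsNext k w v))

/-- The neighbour of `v` in the positive `k`-direction. -/
def up (v : Vertex n) (k : Fin 3) (h : (v k : ℕ) < n k) : Vertex n :=
  Function.update v k ⟨v k + 1, by omega⟩

/-- The direction of the edge between adjacent vertices `v` and `w`. -/
def dir (v w : Vertex n) : Fin 3 := if v 0 ≠ w 0 then 0 else if v 1 ≠ w 1 then 1 else 2

/-- A square face: its normal direction `axis` and its vertex `corner` with the smallest
coordinates. -/
@[ext]
structure Face (n : Fin 3 → ℕ) : Type where
  axis : Fin 3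
  corner : Vertex n
  lt : ∀ k, k ≠ axis → (corner k : ℕ) < n k
  deriving DecidableEq

/-- The faces form a finite type. -/
def Face.equiv (n : Fin 3 → ℕ) :
    {p : Fin 3 × Vertex n // ∀ k, k ≠ p.1 → (p.2 k : ℕ) < n k} ≃ Face n where
  toFun p := ⟨p.1.1, p.1.2, p.2⟩
  invFun f := ⟨(f.axis, f.corner), f.lt⟩
  left_inv _ := rfl
  right_inv _ := rfl

instance : Fintype (Face n) := Fintype.ofEquiv _ (Face.equiv n)

/-- `w` is one of the four vertices of the face `f`. -/
def Face.HasVertex (f : Face n) (w : Vertex n) : Prop :=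
  w f.axis = f.corner f.axis ∧
    ∀ k, k ≠ f.axis → (w k : ℕ) = f.corner k ∨ (w k : ℕ) = f.corner k + 1

instance (f : Face n) (w : Vertex n) : Decidable (f.HasVertex w) :=
  inferInstanceAs (Decidable (_ ∧ _))

/-- A face on the boundary of the lattice. -/
def Face.IsBoundary (f : Face n) : Prop :=
  (f.corner f.axis : ℕ) = 0 ∨ (f.corner f.axis : ℕ) = n f.axis

instance (f : Face n) : Decidable f.IsBoundary := inferInstanceAs (Decidable (_ ∨ _))

/-- Two different faces that lie in a common two-dimensional slice and share an edge. -/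
def Face.AdjInSlice (f g : Face n) : Prop :=
  f.axis = g.axis ∧ ∃ k, k ≠ f.axis ∧ (IsNext k f.corner g.corner ∨ IsNext k g.corner f.corner)

/-- The closed walk around a face. -/
def Face.walk (f : Face n) : (graph n).Walk f.corner f.corner :=
  have ha : f.axis + 1 ≠ f.axis := by simp
  have hb : f.axis + 2 ≠ f.axis := by simp
  have hab : f.axis + 2 ≠ f.axis + 1 := by simp
  have h₁ := f.lt _ ha
  have h₂ := f.lt _ hb
  have h₃ : (up f.corner (f.axis + 1) h₁ (f.axis + 2) : ℕ) < n (f.axis + 2) := by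
    simpa [up, Function.update_of_ne hab] using h₂
  .cons (v := up f.corner (f.axis + 1) h₁)
    ⟨f.axis + 1, .inl ⟨by simp [up], fun l hl => by simp [up, Function.update_of_ne hl]⟩⟩ <|
  .cons (v := up (up f.corner (f.axis + 1) h₁) (f.axis + 2) h₃)
    ⟨f.axis + 2, .inl ⟨by simp [up], fun l hl => by simp [up, Function.update_of_ne hl]⟩⟩ <|
  .cons (v := up f.corner (f.axis + 2) h₂)
    ⟨f.axis + 1, .inr ⟨by simp [up], fun l hl => by
      by_cases h : l = f.axis + 2
      · subst h; simp [up]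
      · simp [up, Function.update_of_ne h, Function.update_of_ne hl]⟩⟩ <|
  .cons
    ⟨f.axis + 2, .inr ⟨by simp [up], fun l hl => by simp [up, Function.update_of_ne hl]⟩⟩ .nil

/-- The cycle around a face, as an element of `M_G`. -/
def faceCycle (f : Face n) : MGroup (graph n) := MGroup.ofWalk (graph n) f.walk

/-- Cubic cells, given by their vertex with the smallest coordinates. -/
abbrev Cell (n : Fin 3 → ℕ) : Type := (k : Fin 3) → Fin (n k)

/-- The face of the cell `c` with normal direction `k` and smaller `k`-coordinate. -/
def Cell.lower (c : Cell n) (k : Fin 3) : Face n where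
  axis := k
  corner l := (c l).castSucc
  lt l _ := (c l).isLt

/-- The face of the cell `c` opposite to `c.lower k`. -/
def Cell.upper (c : Cell n) (k : Fin 3) : Face n where
  axis := k
  corner := Function.update (fun l => (c l).castSucc) k (c k).succ
  lt l h := by simp [Function.update_of_ne h]

/-- `f` is one of the six faces of `c`. -/
def Face.IsFaceOf (f : Face n) (c : Cell n) : Prop := ∃ k, f = c.lower k ∨ f = c.upper k

instance (f : Face n) (c : Cell n) : Decidable (f.IsFaceOf c) :=
  inferInstanceAs (Decidable (∃ _, _))

/-- The cycle around the pair of opposite faces of `c` with normal direction `k`. -/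
def pairCycle (c : Cell n) (k : Fin 3) : MGroup (graph n) :=
  faceCycle (c.lower k) * faceCycle (c.upper k)

/-- The edges around `f` circulate: at each vertex of `f` one of the two edges of `f` points in
and the other one points out. Here `o v w` says that the edge between `v` and `w` points
from `v` to `w`. -/
def IsEvenFace (o : Vertex n → Vertex n → Bool) (f : Face n) : Prop :=
  ∀ u v w, f.HasVertex u → f.HasVertex v → f.HasVertex w →
    (graph n).Adj u v → (graph n).Adj v w → u ≠ w → o u v = o v w

/-- The edges around `f` touch head to head or tail to tail. -/
def IsOddFace (o : Vertex n → Vertex n → Bool) (f : Face n) : Prop :=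
  ∀ u v w, f.HasVertex u → f.HasVertex v → f.HasVertex w →
    (graph n).Adj u v → (graph n).Adj v w → u ≠ w → o u v = o w v

instance (o : Vertex n → Vertex n → Bool) (f : Face n) : Decidable (IsOddFace o f) :=
  inferInstanceAs (Decidable (∀ _, _))

/-- An orientation of the edges of the cubic lattice all of whose two-dimensional slices are
oriented as in the square lattice encoding: the faces of each slice are even or odd in a
checkerboard pattern. -/
structure Orientation (n : Fin 3 → ℕ) : Type where
  /-- For adjacent `v` and `w`, the edge between them points from `v` to `w`. -/
  pointsTo : Vertex n → Vertex n → Bool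
  pointsTo_symm : ∀ v w, (graph n).Adj v w → pointsTo w v = !pointsTo v w
  even_or_odd : ∀ f : Face n, IsEvenFace pointsTo f ∨ IsOddFace pointsTo f
  checkerboard : ∀ f g : Face n, f.AdjInSlice g →
    (IsOddFace pointsTo f ↔ IsEvenFace pointsTo g)

/-- Odd cells: all six faces are odd. -/
def IsOddCell (o : Orientation n) (c : Cell n) : Prop :=
  ∀ f : Face n, f.IsFaceOf c → IsOddFace o.pointsTo f

instance (o : Orientation n) (c : Cell n) : Decidable (IsOddCell o c) :=
  inferInstanceAs (Decidable (∀ _, _))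

/-- Isolated odd faces: odd faces on the boundary that are not faces of an odd cell. -/
def IsIsolatedOddFace (o : Orientation n) (f : Face n) : Prop :=
  IsOddFace o.pointsTo f ∧ f.IsBoundary ∧ ∀ c : Cell n, IsOddCell o c → ¬ f.IsFaceOf c

instance (o : Orientation n) (f : Face n) : Decidable (IsIsolatedOddFace o f) :=
  inferInstanceAs (Decidable (_ ∧ _))

/-- The type of odd faces. -/
abbrev OddFace (o : Orientation n) : Type := {f : Face n // IsOddFace o.pointsTo f}

/-- The type of isolated odd faces. -/
abbrev IsolatedOddFace (o : Orientation n) : Type := {f : Face n // IsIsolatedOddFace o f}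

/-- The type of odd cells. -/
abbrev OddCell (o : Orientation n) : Type := {c : Cell n // IsOddCell o c}

/-- A choice, for every isolated odd face, of an edge of that face; the edge is recorded with
its direction in the orientation `o`. -/
structure EdgeChoice (o : Orientation n) : Type where
  edge : IsolatedOddFace o → (graph n).Dart
  pointsTo : ∀ f, o.pointsTo (edge f).fst (edge f).snd = true
  mem : ∀ f : IsolatedOddFace o, f.1.HasVertex (edge f).fst ∧ f.1.HasVertex (edge f).snd

/-! ### The cubic encoding -/

/-- There is one qubit for every vertex and one for every odd face. -/
abbrev Qubit (o : Orientation n) : Type := Vertex n ⊕ OddFace o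

/-- Operators on the Hilbert space of the qubits. -/
abbrev Op (o : Orientation n) : Type := Matrix (Qubit o → Fin 2) (Qubit o → Fin 2) ℂ

/-- The encoded vertex operator `Z_v`. -/
def vertexOp (o : Orientation n) (v : Vertex n) : Op o :=
  Pauli.tensor fun q => if q = .inl v then Pauli.mat 2 else 1

/-- The operator `X_v Y_w P(v, w)`, where `P(v, w)` acts with the Pauli matrix `X`, `Y` or `Z`,
according to the direction of the edge, on every odd face that the edge bounds. -/
def rawEdgeOp (o : Orientation n) (v w : Vertex n) : Op o :=
  Pauli.tensor fun q => match q with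
    | .inl u => if u = v then Pauli.mat 0 else if u = w then Pauli.mat 1 else 1
    | .inr f => if f.1.HasVertex v ∧ f.1.HasVertex w then Pauli.mat (dir v w) else 1

open Classical in
/-- The encoded operator of an edge that points from `d.fst` to `d.snd`; the sign is `-1` for
the edges that were chosen for the isolated odd faces. -/
noncomputable def forwardOp (o : Orientation n) (χ : EdgeChoice o) (d : (graph n).Dart) : Op o :=
  if ∃ f, χ.edge f = d then -rawEdgeOp o d.fst d.snd else rawEdgeOp o d.fst d.snd

/-- The encoded operator of a directed edge. -/
noncomputable def edgeOp (o : Orientation n) (χ : EdgeChoice o) (d : (graph n).Dart) : Op o :=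
  if o.pointsTo d.fst d.snd then forwardOp o χ d else -forwardOp o χ d.symm

/-- `σ` is the cubic encoding: the representation of `M_G` given by the above operators. It is
determined by these values, since they are prescribed on generators of `M_G`. -/
structure IsEncoding (o : Orientation n) (χ : EdgeChoice o) (σ : MGroup (graph n) →* Op o) :
    Prop where
  phase : σ (MGroup.I (graph n)) = Complex.I • (1 : Op o)
  vert : ∀ v, σ (MGroup.vert (graph n) v) = vertexOp o v
  edge : ∀ d, σ (MGroup.edge (graph n) d) = edgeOp o χ d

/-- The cycles around all isolated odd faces, and around the two pairs of opposite faces with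
normal directions `p c` and `q c` for every odd cell `c`. -/
def kernelGen (o : Orientation n) (p q : OddCell o → Fin 3) :
    IsolatedOddFace o ⊕ (OddCell o ⊕ OddCell o) → MGroup (graph n)
  | .inl f => faceCycle f.1
  | .inr (.inl c) => pairCycle c.1 (p c)
  | .inr (.inr c) => pairCycle c.1 (q c)

end Cubic

/-!
Modulo phases, `M_G` is an elementary abelian 2-group on the vertices and edges, and every vertex
occurs an even number of times in a cycle. Since the phases act faithfully, an element `m` of the
kernel `K` is determined by the set of edges that occur in it an odd number of times.

As `σ m = 1` commutes with every one-qubit Pauli operator, an even number of these edges acts by an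
anticommuting Pauli operator at each qubit. At the qubit of an odd face this says that `m` contains
both or neither of two opposite edges of the face. At the qubit of a vertex it says that every edge
of `m` meets a perpendicular edge of `m` in an odd face. Oddness of faces is governed by the parity
of their coordinates, so an odd face is isolated or belongs to an odd cell. Hence every edge of `m`
lies on the cycle around an isolated odd face, or around two opposite faces of an odd cell, all of
whose edges occur in `m`. Cancelling such cycles one by one exhausts `m`.

The third pair of faces of an odd cell is the product of the other two. Distinct isolated odd faces
and odd cells share no edges, so one edge in a suitable direction detects each generator.
-/

/-! ### Independent generators -/

section Independence

variable {ι M N : Type*} [Group M] {g : ι → M}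

theorem notMem_closure_image_compl_of_dual [Group N] {Φ : ι → M →* N}
    (hΦ : ∀ i j, Φ i (g j) = 1 ↔ i ≠ j) (i : ι) : g i ∉ Subgroup.closure (g '' {i}ᶜ) := by
  have hle : Subgroup.closure (g '' {i}ᶜ) ≤ (Φ i).ker := by
    rw [Subgroup.closure_le]
    rintro _ ⟨j, hj, rfl⟩
    exact (hΦ i j).2 (Ne.symm hj)
  exact fun h => (hΦ i i).1 (hle h) rfl

theorem injective_of_notMem_closure_image_compl
    (h : ∀ i, g i ∉ Subgroup.closure (g '' {i}ᶜ)) : Function.Injective g := by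
  intro i j hij
  by_contra hne
  exact h i (hij ▸ Subgroup.subset_closure ⟨j, Ne.symm hne, rfl⟩)

variable [CommGroup N] {p : ℕ} [Fact p.Prime]

theorem card_le_rank_pi [Fintype ι] [Finite N] (hN : Nat.card N = p) :
    Fintype.card ι ≤ Group.rank (ι → N) := by
  have hdvd := card_dvd_exponent_pow_rank' (ι → N) (n := p) fun x => funext fun i => by
    rw [Pi.pow_apply, ← hN, pow_card_eq_one', Pi.one_apply]
  rw [Nat.card_fun, hN, Nat.card_eq_fintype_card] at hdvd
  exact (Nat.pow_dvd_pow_iff_le_right (Fact.out : p.Prime).one_lt).1 hdvd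

theorem map_pi_closure_range_eq_top_of_dual [Finite ι] (hN : Nat.card N = p)
    {Φ : ι → M →* N} (hΦ : ∀ i j, Φ i (g j) = 1 ↔ i ≠ j) :
    (Subgroup.closure (Set.range g)).map (MonoidHom.pi Φ) = ⊤ := by
  classical
  refine eq_top_iff.2 fun x _ => Subgroup.pi_mem_of_mulSingle_mem x fun i => ?_
  have hgen : Φ i (g i) ≠ 1 := fun h => (hΦ i i).1 h rfl
  have hsingle : MonoidHom.pi Φ (g i) = Pi.mulSingle i (Φ i (g i)) := by
    refine funext fun j => ?_
    rcases eq_or_ne j i with rfl | hj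
    · simp
    · simpa [hj] using (hΦ j i).2 hj
  obtain ⟨k, hk : Φ i (g i) ^ k = x i⟩ := mem_powers_of_prime_card hN hgen
  refine Subgroup.mem_map.2
    ⟨g i ^ k, pow_mem (Subgroup.subset_closure (Set.mem_range_self i)) k, ?_⟩
  rw [map_pow, hsingle, ← Pi.mulSingle_pow, hk]

theorem rank_closure_range_eq_card_of_dual [Fintype ι] (hN : Nat.card N = p)
    {Φ : ι → M →* N} (hΦ : ∀ i j, Φ i (g j) = 1 ↔ i ≠ j)
    [Group.FG (Subgroup.closure (Set.range g))] :
    Group.rank (Subgroup.closure (Set.range g)) = Fintype.card ι := by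
  have : Finite N := Nat.finite_of_card_ne_zero (hN ▸ (Fact.out : p.Prime).ne_zero)
  refine le_antisymm ?_ ?_
  · calc Group.rank (Subgroup.closure (Set.range g))
        ≤ Nat.card (Set.range g) := Subgroup.rank_closure_finite_le_nat_card _
      _ ≤ Nat.card ι := Finite.card_range_le g
      _ = Fintype.card ι := Nat.card_eq_fintype_card
  · have hsurj : Function.Surjective
        ((MonoidHom.pi Φ).comp (Subgroup.closure (Set.range g)).subtype) := by
      rw [← MonoidHom.range_eq_top, MonoidHom.range_comp, Subgroup.range_subtype,
        map_pi_closure_range_eq_top_of_dual hN hΦ]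
    exact (card_le_rank_pi hN).trans (Group.rank_le_of_surjective _ hsurj)

end Independence

/-! ### The group `M_G` modulo phases -/

namespace MGroup

variable {V : Type} {G : SimpleGraph V}

/-- The homomorphism out of `M_G` given by values on the generators that satisfy the relations. -/
def lift {H : Type} [Group H] (f : MGen G → H)
    (hf : ∀ a b, MRel G a b → FreeGroup.lift f a = FreeGroup.lift f b) : MGroup G →* H :=
  PresentedGroup.toGroup (f := f) (by
    rintro r ⟨a, b, hab, rfl⟩
    rw [map_mul, map_inv, hf a b hab, mul_inv_cancel])

theorem lift_of {H : Type} [Group H] (f : MGen G → H)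
    (hf : ∀ a b, MRel G a b → FreeGroup.lift f a = FreeGroup.lift f b) (x : MGen G) :
    lift f hf (PresentedGroup.of x) = f x :=
  PresentedGroup.toGroup.of _

theorem mk_eq_mk_of_rel {a b : FreeGroup (MGen G)} (h : MRel G a b) :
    PresentedGroup.mk {r : FreeGroup (MGen G) | ∃ a b, MRel G a b ∧ r = a * b⁻¹} a =
      PresentedGroup.mk _ b :=
  PresentedGroup.mk_eq_mk_of_mul_inv_mem ⟨a, b, h, rfl⟩

theorem I_pow_four : I G ^ 4 = 1 :=
  mk_eq_mk_of_rel MRel.phase_order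

theorem vert_sq (x : V) : vert G x ^ 2 = 1 :=
  mk_eq_mk_of_rel (MRel.vert_sq x)

theorem edge_sq (d : G.Dart) : edge G d ^ 2 = 1 :=
  mk_eq_mk_of_rel (MRel.edge_sq d)

theorem edge_symm (d : G.Dart) : edge G d = I G ^ 2 * edge G d.symm :=
  mk_eq_mk_of_rel (MRel.edge_symm d)

theorem commute_I_of (x : MGen G) : Commute (I G) (PresentedGroup.of x) :=
  mk_eq_mk_of_rel (MRel.phase_central x)

theorem commute_vert_vert (x y : V) : Commute (vert G x) (vert G y) :=
  mk_eq_mk_of_rel (MRel.vert_vert x y)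

theorem commute_edge_vert {d : G.Dart} {x : V} (h₁ : x ≠ d.fst) (h₂ : x ≠ d.snd) :
    Commute (edge G d) (vert G x) :=
  mk_eq_mk_of_rel (MRel.edge_vert_comm d x h₁ h₂)

theorem commute_edge_edge {d d' : G.Dart} (h₁ : d.fst ≠ d'.fst) (h₂ : d.fst ≠ d'.snd)
    (h₃ : d.snd ≠ d'.fst) (h₄ : d.snd ≠ d'.snd) : Commute (edge G d) (edge G d') :=
  mk_eq_mk_of_rel (MRel.edge_edge_comm d d' h₁ h₂ h₃ h₄)

theorem edge_mul_vert_snd (d : G.Dart) :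
    edge G d * vert G d.snd = I G ^ 2 * (vert G d.snd * edge G d) :=
  mk_eq_mk_of_rel (MRel.edge_vert_anti d)

theorem edge_mul_edge_of_snd_eq_fst {d d' : G.Dart} (h : d.snd = d'.fst) (h' : d.fst ≠ d'.snd) :
    edge G d * edge G d' = I G ^ 2 * (edge G d' * edge G d) :=
  mk_eq_mk_of_rel (MRel.edge_edge_anti d d' h h')

theorem closure_range_of : Subgroup.closure (Set.range fun x : MGen G =>
    (PresentedGroup.of x : MGroup G)) = ⊤ :=
  PresentedGroup.closure_range_of _

theorem commute_map_of_generators {H : Type} [Group H] {f : MGroup G →* H} {h : H}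
    (hf : ∀ x, Commute h (f (PresentedGroup.of x))) (m : MGroup G) : Commute h (f m) := by
  have hle : ⊤ ≤ (Subgroup.centralizer {h}).comap f := by
    rw [← closure_range_of, Subgroup.closure_le]
    rintro _ ⟨x, rfl⟩
    exact Subgroup.mem_centralizer_singleton_iff.2 (hf x).eq.symm
  exact (Subgroup.mem_centralizer_singleton_iff.1 (hle trivial)).symm

theorem I_mem_center : I G ∈ Subgroup.center (MGroup G) :=
  Subgroup.mem_center_iff.2 fun m =>
    (commute_map_of_generators (f := MonoidHom.id _) commute_I_of m).eq.symm

instance normal_zpowers_I : (Subgroup.zpowers (I G)).Normal :=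
  ⟨fun x hx a => by
    rwa [Subgroup.mem_center_iff.1 (Subgroup.zpowers_le.2 I_mem_center hx) a,
      mul_inv_cancel_right]⟩

variable (G) in
/-- The projection of `M_G` to the quotient by its phases. -/
def modPhase : MGroup G →* MGroup G ⧸ Subgroup.zpowers (I G) :=
  QuotientGroup.mk' _

theorem modPhase_I : modPhase G (I G) = 1 :=
  (QuotientGroup.eq_one_iff _).2 (Subgroup.mem_zpowers _)

theorem modPhase_edge_symm (d : G.Dart) :
    modPhase G (edge G d.symm) = modPhase G (edge G d) := by
  rw [edge_symm d, map_mul, map_pow, modPhase_I, one_pow, one_mul]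

theorem commute_modPhase_edge_vert (d : G.Dart) (x : V) :
    Commute (modPhase G (edge G d)) (modPhase G (vert G x)) := by
  have snd (d : G.Dart) : Commute (modPhase G (edge G d)) (modPhase G (vert G d.snd)) := by
    simpa [modPhase_I, Commute, SemiconjBy] using congrArg (modPhase G) (edge_mul_vert_snd d)
  by_cases hsnd : x = d.snd
  · exact hsnd ▸ snd d
  by_cases hfst : x = d.fst
  · rw [hfst, ← modPhase_edge_symm]
    exact snd d.symm
  exact (commute_edge_vert hfst hsnd).map _

theorem commute_modPhase_edge_edge (d d' : G.Dart) :
    Commute (modPhase G (edge G d)) (modPhase G (edge G d')) := by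
  have chain (d d' : G.Dart) (h : d.snd = d'.fst) :
      Commute (modPhase G (edge G d)) (modPhase G (edge G d')) := by
    by_cases h' : d.fst = d'.snd
    · rw [show d' = d.symm from SimpleGraph.Dart.ext _ _ (Prod.ext h.symm h'.symm),
        modPhase_edge_symm]
    · simpa [modPhase_I, Commute, SemiconjBy] using
        congrArg (modPhase G) (edge_mul_edge_of_snd_eq_fst h h')
  by_cases h₁ : d.snd = d'.fst
  · exact chain d d' h₁
  by_cases h₂ : d.snd = d'.snd
  · exact modPhase_edge_symm d' ▸ chain d d'.symm h₂
  by_cases h₃ : d.fst = d'.fst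
  · exact modPhase_edge_symm d ▸ chain d.symm d' h₃
  by_cases h₄ : d.fst = d'.snd
  · exact modPhase_edge_symm d ▸ modPhase_edge_symm d' ▸ chain d.symm d'.symm h₄
  exact (commute_edge_edge h₃ h₄ h₁ h₂).map _

theorem commute_modPhase (a b : MGroup G) : Commute (modPhase G a) (modPhase G b) := by
  refine commute_map_of_generators (fun x => (commute_map_of_generators (fun y => ?_) a).symm) b
  match x, y with
  | .phase, _ => exact modPhase_I (G := G) ▸ Commute.one_left _
  | _, .phase => exact modPhase_I (G := G) ▸ Commute.one_right _
  | .vert x, .vert y => exact (commute_vert_vert x y).map _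
  | .vert x, .edge d => exact (commute_modPhase_edge_vert d x).symm
  | .edge d, .vert x => exact commute_modPhase_edge_vert d x
  | .edge d, .edge d' => exact commute_modPhase_edge_edge d d'

instance : CommGroup (MGroup G ⧸ Subgroup.zpowers (I G)) where
  mul_comm := by
    intro x y
    obtain ⟨a, rfl⟩ := QuotientGroup.mk'_surjective _ x
    obtain ⟨b, rfl⟩ := QuotientGroup.mk'_surjective _ y
    exact commute_modPhase a b

end MGroup

/-! ### Occurrences of the generators modulo two -/

section ProdOfInvolutions

variable {B H : Type*} [CommGroup H]

/-- The homomorphism from the elementary abelian `2`-group on `B` that sends the basis elements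
to the given involutions. -/
noncomputable def prodOfInvolutions (t : B → H) (ht : ∀ b, t b ^ 2 = 1) :
    Multiplicative (B →₀ ZMod 2) →* H where
  toFun x := x.toAdd.prod fun b k => t b ^ k.val
  map_one' := Finsupp.prod_zero_index
  map_mul' x y := Finsupp.prod_add_index' (fun b => by simp) fun b k l => by
    rw [ZMod.val_add, ← pow_add, eq_comm]
    exact pow_eq_pow_mod _ (ht b)

variable (t : B → H) (ht : ∀ b, t b ^ 2 = 1)

theorem prodOfInvolutions_single (b : B) :
    prodOfInvolutions t ht (.ofAdd (.single b 1)) = t b :=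
  calc (Finsupp.single b (1 : ZMod 2)).prod (fun b k => t b ^ k.val)
    _ = t b ^ (1 : ZMod 2).val := Finsupp.prod_single_index (pow_zero _)
    _ = t b := pow_one _

theorem prodOfInvolutions_eq_prod_support (x : Multiplicative (B →₀ ZMod 2)) :
    prodOfInvolutions t ht x = ∏ b ∈ x.toAdd.support, t b :=
  Finset.prod_congr rfl fun b hb => by
    have hval : ∀ k : ZMod 2, k ≠ 0 → k.val = 1 := by decide
    simp only [hval _ (Finsupp.mem_support_iff.1 hb), pow_one]

end ProdOfInvolutions

namespace MGroup

variable {V : Type} {G : SimpleGraph V}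

/-- The basis element of the elementary abelian `2`-group on the vertices and edges that belongs
to a generator of `M_G`. -/
noncomputable def genContent : MGen G → (V ⊕ Sym2 V →₀ ZMod 2)
  | .phase => 0
  | .vert x => .single (.inl x) 1
  | .edge d => .single (.inr d.edge) 1

variable (G) in
/-- The homomorphism that counts, modulo two, how often each vertex and each edge occurs in an
element of `M_G`. -/
noncomputable def content : MGroup G →* Multiplicative (V ⊕ Sym2 V →₀ ZMod 2) :=
  lift (fun x => .ofAdd (genContent x)) (by
    have sq (x : Multiplicative (V ⊕ Sym2 V →₀ ZMod 2)) : x ^ 2 = 1 :=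
      congrArg Multiplicative.ofAdd (show 2 • x.toAdd = 0 by
        rw [two_nsmul]; exact Finsupp.ext fun b => CharTwo.add_self_eq_zero _)
    intro a b h
    cases h <;>
      simp only [MGen.I, MGen.v, MGen.e, map_mul, map_pow, FreeGroup.lift_apply_of, map_one, sq,
        one_mul, genContent, SimpleGraph.Dart.edge_symm, mul_comm]
    rw [show 4 = 2 * 2 from rfl, pow_mul, sq])

theorem content_I : content G (I G) = 1 := lift_of ..

theorem content_vert (x : V) : content G (vert G x) = .ofAdd (.single (.inl x) 1) := lift_of ..

theorem content_edge (d : G.Dart) : content G (edge G d) = .ofAdd (.single (.inr d.edge) 1) :=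
  lift_of ..

open Classical in
variable (G) in
/-- The classes modulo phases of the vertices and edges of `G`. -/
noncomputable def basisModPhase : V ⊕ Sym2 V → MGroup G ⧸ Subgroup.zpowers (I G) :=
  Sum.elim (fun x => modPhase G (vert G x)) <| Sym2.lift
    ⟨fun x y => if h : G.Adj x y then modPhase G (edge G ⟨(x, y), h⟩) else 1, fun x y => by
      simp only [G.adj_comm x y]
      split_ifs with h
      · exact modPhase_edge_symm ⟨(y, x), h⟩
      · rfl⟩

theorem basisModPhase_edge (d : G.Dart) :
    basisModPhase G (.inr d.edge) = modPhase G (edge G d) :=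
  dif_pos d.adj

theorem basisModPhase_sq (b : V ⊕ Sym2 V) : basisModPhase G b ^ 2 = 1 := by
  match b with
  | .inl x => exact (map_pow (modPhase G) _ 2).symm.trans (by rw [vert_sq, map_one])
  | .inr e =>
    induction e with | h x y =>
    by_cases h : G.Adj x y
    · rw [show s(x, y) = (⟨(x, y), h⟩ : G.Dart).edge from rfl, basisModPhase_edge, ← map_pow,
        edge_sq, map_one]
    · rw [show basisModPhase G (.inr s(x, y)) = 1 from dif_neg h, one_pow]

theorem prodOfInvolutions_content (m : MGroup G) :
    prodOfInvolutions (basisModPhase G) basisModPhase_sq (content G m) = modPhase G m := by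
  suffices h : (prodOfInvolutions (basisModPhase G) basisModPhase_sq).comp (content G) =
      modPhase G from DFunLike.congr_fun h m
  refine PresentedGroup.ext fun x => ?_
  rw [MonoidHom.comp_apply]
  match x with
  | .phase => exact (congrArg _ content_I).trans ((map_one _).trans modPhase_I.symm)
  | .vert x => exact (congrArg _ (content_vert x)).trans (prodOfInvolutions_single ..)
  | .edge d =>
    exact (congrArg _ (content_edge d)).trans
      ((prodOfInvolutions_single ..).trans (basisModPhase_edge d))

theorem mem_zpowers_I_of_content_eq_one {m : MGroup G} (hm : content G m = 1) :
    m ∈ Subgroup.zpowers (I G) :=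
  (QuotientGroup.eq_one_iff _).1 <| show modPhase G m = 1 by
    rw [← prodOfInvolutions_content, hm, map_one]

theorem eq_one_of_content_eq_one {A : Type*} [Monoid A] {σ : MGroup G →* A}
    (hI : orderOf (σ (I G)) = 4) {m : MGroup G} (hm : content G m = 1) (hσ : σ m = 1) : m = 1 := by
  have hfin : IsOfFinOrder (I G) := isOfFinOrder_iff_pow_eq_one.2 ⟨4, by norm_num, I_pow_four⟩
  obtain ⟨k, rfl : I G ^ k = m⟩ :=
    hfin.mem_powers_iff_mem_zpowers.2 (mem_zpowers_I_of_content_eq_one hm)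
  rw [map_pow, ← orderOf_dvd_iff_pow_eq_one, hI] at hσ
  obtain ⟨j, rfl⟩ := hσ
  rw [pow_mul, I_pow_four, one_pow]

variable (G) in
/-- The homomorphism that counts, modulo two, how often a given vertex or edge occurs in an
element of `M_G`. -/
noncomputable def contentAt (b : V ⊕ Sym2 V) : MGroup G →* Multiplicative (ZMod 2) :=
  (Finsupp.applyAddHom b).toMultiplicative.comp (content G)

theorem content_inl_of_mem_cycles {m : MGroup G} (hm : m ∈ cycles G) (x : V) :
    (content G m).toAdd (.inl x) = 0 := by
  have hI : contentAt G (.inl x) (I G) = 1 := by simp [contentAt, content_I]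
  have hedge (d : G.Dart) : contentAt G (.inl x) (edge G d) = 1 := by
    simp [contentAt, content_edge]
  suffices hle : cycles G ≤ (contentAt G (.inl x)).ker from hle hm
  rw [cycles, Subgroup.closure_le]
  rintro _ ⟨y, p, rfl⟩
  have hfun : contentAt G (.inl x) ∘ edge G = fun _ => 1 := funext hedge
  simp [MonoidHom.mem_ker, ofWalk, map_list_prod, hI, hfun]

/-- The set of edges that occur an odd number of times in an element of `M_G`. -/
def oddEdges (m : MGroup G) : Set (Sym2 V) :=
  {e | (content G m).toAdd (.inr e) ≠ 0}

theorem oddEdges_mul (a b : MGroup G) :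
    oddEdges (a * b) = symmDiff (oddEdges a) (oddEdges b) := by
  have hadd : ∀ k l : ZMod 2, k + l ≠ 0 ↔ k ≠ 0 ∧ ¬ l ≠ 0 ∨ l ≠ 0 ∧ ¬ k ≠ 0 := by decide
  ext e
  rw [Set.mem_symmDiff]
  simp only [oddEdges, map_mul, Set.mem_ofPred_eq]
  exact hadd _ _

theorem oddEdges_inv (a : MGroup G) : oddEdges a⁻¹ = oddEdges a := by
  simp [oddEdges]

theorem mem_oddEdges {m : MGroup G} {e : Sym2 V} :
    e ∈ oddEdges m ↔ contentAt G (.inr e) m ≠ 1 :=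
  Iff.rfl

theorem oddEdges_subset_edgeSet (m : MGroup G) : oddEdges m ⊆ G.edgeSet := fun e hm => by
  classical
  by_contra he
  refine hm (DFunLike.congr_fun (f := contentAt G (.inr e)) (g := 1) ?_ m)
  refine PresentedGroup.ext fun x => ?_
  rw [contentAt, MonoidHom.comp_apply]
  match x with
  | .phase => exact congrArg _ content_I
  | .vert x => exact (congrArg _ (content_vert x)).trans (by simp)
  | .edge d =>
    refine (congrArg _ (content_edge d)).trans (congrArg Multiplicative.ofAdd ?_)
    exact (Finsupp.single_apply ..).trans (if_neg fun h =>
      he ((Sum.inr.inj h : d.edge = e) ▸ d.edge_mem))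

theorem finite_oddEdges (m : MGroup G) : (oddEdges m).Finite :=
  (content G m).toAdd.hasFiniteSupport.preimage Sum.inr_injective.injOn

theorem eq_one_of_oddEdges_eq_empty {A : Type} [Monoid A] {σ : MGroup G →* A}
    (hI : orderOf (σ (I G)) = 4) {m : MGroup G} (hm : m ∈ cycleKernel G σ)
    (hodd : oddEdges m = ∅) : m = 1 := by
  refine eq_one_of_content_eq_one hI (Multiplicative.toAdd.injective (Finsupp.ext fun b => ?_)) hm.2
  rcases b with x | e
  · exact content_inl_of_mem_cycles hm.1 x
  · exact not_not.1 (Set.eq_empty_iff_forall_notMem.1 hodd e)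

theorem eq_of_oddEdges_eq {A : Type} [Monoid A] {σ : MGroup G →* A}
    (hI : orderOf (σ (I G)) = 4) {a b : MGroup G} (ha : a ∈ cycleKernel G σ)
    (hb : b ∈ cycleKernel G σ) (h : oddEdges a = oddEdges b) : a = b :=
  mul_inv_eq_one.1 <| eq_one_of_oddEdges_eq_empty hI (mul_mem ha (inv_mem hb)) <| by
    rw [oddEdges_mul, oddEdges_inv, h, symmDiff_self, Set.bot_eq_empty]

theorem oddEdges_edge (d : G.Dart) : oddEdges (edge G d) = {d.edge} := by
  classical
  ext e
  simp [oddEdges, content_edge, Finsupp.single_apply, eq_comm]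

theorem oddEdges_prod_edge {l : List G.Dart} (hl : (l.map SimpleGraph.Dart.edge).Nodup) :
    oddEdges (l.map (edge G)).prod = {e | e ∈ l.map SimpleGraph.Dart.edge} := by
  induction l with
  | nil => simp [oddEdges]
  | cons d l ih =>
    rw [List.map_cons, List.nodup_cons] at hl
    have hdisj : Disjoint {d.edge} {e | e ∈ l.map SimpleGraph.Dart.edge} :=
      Set.disjoint_singleton_left.2 hl.1
    rw [List.map_cons, List.prod_cons, oddEdges_mul, oddEdges_edge, ih hl.2, hdisj.symmDiff_eq_sup]
    ext e
    simp

theorem oddEdges_ofWalk_of_isTrail {x y : V} {p : G.Walk x y} (hp : p.IsTrail) :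
    oddEdges (ofWalk G p) = {e | e ∈ p.edges} := by
  have hI : oddEdges (I G ^ p.length) = ⊥ := by simp [oddEdges, content_I]
  rw [ofWalk, oddEdges_mul, hI, bot_symmDiff, oddEdges_prod_edge hp.edges_nodup]
  rfl

/-! ### Test operators -/

theorem map_mul_of_generators {A : Type*} [Ring A] {σ : MGroup G →* A} {T : A}
    {ε : MGroup G →* ℤˣ}
    (h : ∀ x, σ (PresentedGroup.of x) * T = ε (PresentedGroup.of x) •
      (T * σ (PresentedGroup.of x))) (m : MGroup G) : σ m * T = ε m • (T * σ m) := by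
  have hm : m ∈ Subgroup.closure (Set.range PresentedGroup.of) := closure_range_of ▸ trivial
  induction hm using Subgroup.closure_induction with
  | mem _ hx => obtain ⟨x, rfl⟩ := hx; exact h x
  | one => simp
  | mul a b _ _ ha hb =>
    rw [map_mul, map_mul, mul_assoc, hb, mul_smul_comm, ← mul_assoc, ha, smul_mul_assoc, smul_smul,
      mul_assoc, mul_comm]
  | inv a _ ha =>
    have hinv : σ a * σ a⁻¹ = 1 := by rw [← map_mul, mul_inv_cancel, map_one]
    have hinv' : σ a⁻¹ * σ a = 1 := by rw [← map_mul, inv_mul_cancel, map_one]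
    calc σ a⁻¹ * T = (ε a)⁻¹ • (σ a⁻¹ * (ε a • (T * σ a)) * σ a⁻¹) := by
          rw [mul_smul_comm, smul_mul_assoc, inv_smul_smul, mul_assoc, mul_assoc, hinv, mul_one]
      _ = ε a⁻¹ • (T * σ a⁻¹) := by rw [← ha, ← mul_assoc, hinv', one_mul, map_inv ε]

/-- The homomorphism from `M_G` to `{±1}` with the given values on vertices and edges. -/
noncomputable def sign (s : V ⊕ Sym2 V → ℤˣ) : MGroup G →* ℤˣ :=
  (prodOfInvolutions s fun b => Int.units_sq (s b)).comp (content G)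

section Sign

variable {s : V ⊕ Sym2 V → ℤˣ}

theorem sign_I : sign s (I G) = 1 := by
  rw [sign, MonoidHom.comp_apply, content_I, map_one]

theorem sign_vert (x : V) : sign s (vert G x) = s (.inl x) := by
  rw [sign, MonoidHom.comp_apply, content_vert, prodOfInvolutions_single]

theorem sign_edge (d : G.Dart) : sign s (edge G d) = s (.inr d.edge) := by
  rw [sign, MonoidHom.comp_apply, content_edge, prodOfInvolutions_single]

theorem sign_eq_of_forall_ne {m : MGroup G} (hm : m ∈ cycles G) {e : Sym2 V} (he : e ∈ oddEdges m)
    (hs : ∀ e' ∈ oddEdges m, e' ≠ e → s (.inr e') = 1) : sign s m = s (.inr e) := by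
  rw [sign, MonoidHom.comp_apply, prodOfInvolutions_eq_prod_support]
  refine Finset.prod_eq_single_of_mem _ (Finsupp.mem_support_iff.2 he) ?_
  rintro (x | e') hb hne
  · exact absurd (content_inl_of_mem_cycles hm x) (Finsupp.mem_support_iff.1 hb)
  · exact hs e' (Finsupp.mem_support_iff.1 hb) fun h => hne (h ▸ rfl)

/-- An operator `T` that commutes or anticommutes with the images of the generators anticommutes
with an even number of edges of `m`, since it commutes with `σ m = 1`. -/
theorem exists_mem_oddEdges_ne {A : Type} [Ring A] {σ : MGroup G →* A} {T : A} (hT : T ≠ -T)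
    (hI : Commute (σ (I G)) T)
    (hv : ∀ x, σ (vert G x) * T = s (.inl x) • (T * σ (vert G x)))
    (he : ∀ d, σ (edge G d) * T = s (.inr d.edge) • (T * σ (edge G d)))
    {m : MGroup G} (hm : m ∈ cycleKernel G σ) {e : Sym2 V} (hem : e ∈ oddEdges m)
    (hse : s (.inr e) = -1) : ∃ e' ∈ oddEdges m, e' ≠ e ∧ s (.inr e') = -1 := by
  have hgen (x : MGen G) : σ (PresentedGroup.of x) * T =
      sign s (PresentedGroup.of x) • (T * σ (PresentedGroup.of x)) := by
    match x with
    | .phase => exact (sign_I (G := G) (s := s)).symm ▸ (one_smul ℤˣ (T * _)).symm ▸ hI.eq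
    | .vert x => exact (sign_vert (G := G) (s := s) x).symm ▸ hv x
    | .edge d => exact (sign_edge (s := s) d).symm ▸ he d
  by_contra! hs
  have hsign : sign s m = -1 := hse ▸ sign_eq_of_forall_ne hm.1 hem fun e' he' hne =>
    (Int.units_eq_one_or _).resolve_right (hs e' he' hne)
  apply hT
  simpa [show σ m = 1 from hm.2, hsign] using map_mul_of_generators hgen m

end Sign

end MGroup

/-! ### Products of Pauli operators -/

namespace Pauli

theorem mat_mul_mat_self (k : Fin 3) : mat k * mat k = 1 := by
  fin_cases k <;> ext i j <;> fin_cases i <;> fin_cases j <;> simp [mat, Matrix.mul_apply]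

theorem mat_mul_mat_of_ne {k l : Fin 3} (h : k ≠ l) : mat k * mat l = -(mat l * mat k) := by
  fin_cases k <;> fin_cases l <;> first
    | exact absurd rfl h
    | ext i j; fin_cases i <;> fin_cases j <;> simp [mat, Matrix.mul_apply]

/-- The matrices from which products of Pauli operators are built: `some k` stands for the Pauli
matrix `mat k`, and `none` for the identity. -/
def opt (a : Option (Fin 3)) : Matrix (Fin 2) (Fin 2) ℂ := a.elim 1 mat

/-- The sign in the commutation relation of `opt a` and `opt b`: different Pauli matrices
anticommute. -/
def commSign : Option (Fin 3) → Option (Fin 3) → ℤˣ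
  | some k, some l => if k = l then 1 else -1
  | _, _ => 1

theorem opt_mul_opt_self (a : Option (Fin 3)) : opt a * opt a = 1 := by
  cases a with
  | none => exact one_mul 1
  | some k => exact mat_mul_mat_self k

theorem opt_mul_opt (a b : Option (Fin 3)) : opt a * opt b = commSign a b • (opt b * opt a) := by
  match a, b with
  | none, none => exact (one_smul ℤˣ _).symm
  | none, some l => simp [opt, commSign]
  | some k, none => simp [opt, commSign]
  | some k, some l =>
    by_cases h : k = l
    · simp [commSign, h]
    · simpa [opt, commSign, h, Units.smul_def] using mat_mul_mat_of_ne h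

theorem commSign_none_left (b : Option (Fin 3)) : commSign none b = 1 := by
  cases b <;> rfl

theorem commSign_none_right (a : Option (Fin 3)) : commSign a none = 1 := by
  cases a <;> rfl

theorem commSign_some_some (k l : Fin 3) :
    commSign (some k) (some l) = if k = l then 1 else -1 := rfl

variable {Q : Type} [Fintype Q]

theorem tensor_mul [DecidableEq Q] (P R : Q → Matrix (Fin 2) (Fin 2) ℂ) :
    tensor P * tensor R = tensor fun q => P q * R q := by
  ext a b
  simp only [tensor, Matrix.mul_apply, Matrix.of_apply]
  rw [Finset.prod_univ_sum, Fintype.piFinset_univ]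
  exact Finset.sum_congr rfl fun x _ => Finset.prod_mul_distrib.symm

theorem tensor_one : tensor (fun _ : Q => (1 : Matrix (Fin 2) (Fin 2) ℂ)) = 1 := by
  ext a b
  simp only [tensor, Matrix.of_apply, Matrix.one_apply, Finset.prod_ite_zero, Finset.mem_univ,
    forall_const, Finset.prod_const_one, funext_iff]

theorem tensor_units_smul (c : Q → ℤˣ) (P : Q → Matrix (Fin 2) (Fin 2) ℂ) :
    tensor (fun q => c q • P q) = (∏ q, c q) • tensor P := by
  ext a b
  simp only [tensor, Matrix.of_apply, Matrix.smul_apply, Units.smul_def, zsmul_eq_mul,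
    Finset.prod_mul_distrib, Units.coe_prod, Int.cast_prod]

/-- A product of Pauli matrices on different qubits. -/
def word (a : Q → Option (Fin 3)) : Matrix (Q → Fin 2) (Q → Fin 2) ℂ :=
  tensor fun q => opt (a q)

variable [DecidableEq Q]

theorem word_mul_self (a : Q → Option (Fin 3)) : word a * word a = 1 := by
  simp only [word, tensor_mul, opt_mul_opt_self, tensor_one]

theorem word_mul_word (a b : Q → Option (Fin 3)) :
    word a * word b = (∏ q, commSign (a q) (b q)) • (word b * word a) := by
  simp only [word, tensor_mul]
  rw [← tensor_units_smul]
  exact congrArg tensor (funext fun q => opt_mul_opt _ _)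

/-- The operator with the Pauli matrix `mat k` on the qubit `q` is `word (single q k)`. -/
def single (q : Q) (k : Fin 3) : Q → Option (Fin 3) := fun r => if r = q then some k else none

theorem word_mul_word_single (a : Q → Option (Fin 3)) (q : Q) (k : Fin 3) :
    word a * word (single q k) = commSign (a q) (some k) • (word (single q k) * word a) := by
  rw [word_mul_word, Fintype.prod_eq_single q fun r hr => by
    rw [single, if_neg hr, commSign_none_right], single, if_pos rfl]

omit [DecidableEq Q] in
theorem word_ne_neg_word (a : Q → Option (Fin 3)) : word a ≠ -word a := fun h => by
  classical
  have h_unit : IsUnit (word a) := IsUnit.of_mul_eq_one _ (word_mul_self a)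
  have h_double : (2 : ℂ) • word a = 0 := (two_smul ℂ _).trans (add_eq_zero_iff_eq_neg.2 h)
  exact h_unit.ne_zero ((smul_eq_zero.1 h_double).resolve_left two_ne_zero)

end Pauli

/-! ### Edges and faces of the cubic lattice -/

namespace Cubic

variable {n : Fin 3 → ℕ}

theorem exists_third {k l : Fin 3} (h : k ≠ l) :
    ∃ m, m ≠ k ∧ m ≠ l ∧ ∀ j, j = k ∨ j = l ∨ j = m := by
  revert k l; decide

theorem eq_of_ne_of_ne {k l i j : Fin 3} (hkl : k ≠ l) (hi : i ≠ k ∧ i ≠ l) (hj : j ≠ k ∧ j ≠ l) :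
    i = j := by
  revert k l i j; decide

theorem vertex_ext {v w : Vertex n} (h : ∀ k, (v k : ℕ) = w k) : v = w :=
  funext fun k => Fin.ext (h k)

/-- `v` and `w` are the two ends of an edge in direction `k`. -/
def Along (k : Fin 3) (v w : Vertex n) : Prop := IsNext k v w ∨ IsNext k w v

theorem Along.ne {k : Fin 3} {v w : Vertex n} (h : Along k v w) : v k ≠ w k := by
  rintro heq
  rcases h with h | h <;> exact absurd h.1 (by rw [heq]; omega)

theorem Along.eq_of_ne {k l : Fin 3} {v w : Vertex n} (h : Along k v w) (hl : l ≠ k) :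
    v l = w l :=
  h.elim (fun h => (h.2 l hl).symm) fun h => h.2 l hl

theorem Along.dir_eq {k : Fin 3} {v w : Vertex n} (h : Along k v w) : dir v w = k := by
  have hl {l : Fin 3} (hl : l ≠ k) : v l = w l := h.eq_of_ne hl
  fin_cases k
  · exact if_pos h.ne
  · rw [dir, if_neg (not_not.2 (hl (by decide)))]
    exact if_pos h.ne
  · rw [dir, if_neg (not_not.2 (hl (by decide))), if_neg (not_not.2 (hl (by decide)))]
    rfl

/-- The direction of a directed edge. -/
def dartDir (d : (graph n).Dart) : Fin 3 := dir d.fst d.snd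

theorem along_dartDir (d : (graph n).Dart) : Along (dartDir d) d.fst d.snd := by
  obtain ⟨k, hk : Along k d.fst d.snd⟩ := d.adj
  rwa [dartDir, hk.dir_eq]

theorem dartDir_symm (d : (graph n).Dart) : dartDir d.symm = dartDir d :=
  Along.dir_eq (along_dartDir d).symm

/-- The end of a directed edge with the smaller coordinates. -/
def base (d : (graph n).Dart) : Vertex n := fun k => min (d.fst k) (d.snd k)

theorem mem_edge_iff {d : (graph n).Dart} {u : Vertex n} :
    u ∈ d.edge ↔ ((u (dartDir d) : ℕ) = base d (dartDir d) ∨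
      (u (dartDir d) : ℕ) = base d (dartDir d) + 1) ∧ ∀ l, l ≠ dartDir d → u l = base d l := by
  have h := along_dartDir d
  have hbase (l : Fin 3) (hl : l ≠ dartDir d) : base d l = d.fst l ∧ base d l = d.snd l := by
    simp only [base, h.eq_of_ne hl, min_self, and_self]
  have hdir : (base d (dartDir d) : ℕ) = min (d.fst (dartDir d) : ℕ) (d.snd (dartDir d)) := by
    simp only [base, Fin.coe_min]
  have hsucc := h.imp And.left And.left
  rw [show d.edge = s(d.fst, d.snd) from rfl, Sym2.mem_iff]
  constructor
  · rintro (rfl | rfl)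
    · exact ⟨by omega, fun l hl => (hbase l hl).1.symm⟩
    · exact ⟨by omega, fun l hl => (hbase l hl).2.symm⟩
  · rintro ⟨hu, hul⟩
    by_cases hfst : (u (dartDir d) : ℕ) = d.fst (dartDir d)
    · refine .inl (funext fun l => ?_)
      obtain rfl | hl := eq_or_ne l (dartDir d)
      exacts [Fin.ext hfst, (hul l hl).trans (hbase l hl).1]
    · refine .inr (funext fun l => ?_)
      obtain rfl | hl := eq_or_ne l (dartDir d)
      exacts [Fin.ext (by omega), (hul l hl).trans (hbase l hl).2]

theorem edge_eq_of_base_eq {d d' : (graph n).Dart} (h : dartDir d = dartDir d')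
    (hb : ∀ l, (base d l : ℕ) = base d' l) : d.edge = d'.edge := by
  refine Sym2.ext fun u => ?_
  rw [mem_edge_iff, mem_edge_iff, h, vertex_ext hb]

theorem base_mem_edge (d : (graph n).Dart) : base d ∈ d.edge :=
  mem_edge_iff.2 ⟨.inl rfl, fun _ _ => rfl⟩

theorem base_lt (d : (graph n).Dart) : (base d (dartDir d) : ℕ) < n (dartDir d) := by
  have hsucc := (along_dartDir d).imp And.left And.left
  have hfst := (d.fst (dartDir d)).isLt
  have hsnd := (d.snd (dartDir d)).isLt
  simp only [base, Fin.coe_min]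
  omega

theorem isNext_up (v : Vertex n) (k : Fin 3) (h : (v k : ℕ) < n k) : IsNext k v (up v k h) :=
  ⟨by simp [up], fun l hl => by simp [up, hl]⟩

/-- The directed edge from `v` to its neighbour in the positive `k`-direction. -/
def upDart (v : Vertex n) (k : Fin 3) (h : (v k : ℕ) < n k) : (graph n).Dart :=
  ⟨(v, up v k h), k, .inl (isNext_up v k h)⟩

theorem dartDir_upDart (v : Vertex n) (k : Fin 3) (h : (v k : ℕ) < n k) :
    dartDir (upDart v k h) = k :=
  Along.dir_eq (.inl (isNext_up v k h))

theorem base_upDart (v : Vertex n) (k : Fin 3) (h : (v k : ℕ) < n k) : base (upDart v k h) = v := by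
  funext l
  refine min_eq_left ?_
  change v l ≤ up v k h l
  obtain rfl | hl := eq_or_ne l k
  · exact Fin.le_def.2 ((isNext_up v l h).1 ▸ Nat.le_succ _)
  · exact ((isNext_up v k h).2 l hl).ge

namespace Face

/-- `e` is an edge of the face `f`. -/
def HasEdge (f : Face n) (e : Sym2 (Vertex n)) : Prop := ∀ u ∈ e, f.HasVertex u

variable {f g : Face n} {d d' : (graph n).Dart}

theorem hasEdge_edge : f.HasEdge d.edge ↔ f.HasVertex d.fst ∧ f.HasVertex d.snd := Sym2.ball

instance : Decidable (f.HasEdge d.edge) := decidable_of_iff _ hasEdge_edge.symm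

theorem ext_val (h : f.axis = g.axis) (hc : ∀ k, (f.corner k : ℕ) = g.corner k) : f = g :=
  Face.ext h (vertex_ext hc)

theorem hasVertex_corner : f.HasVertex f.corner := ⟨rfl, fun _ _ => .inl rfl⟩

theorem hasEdge_edge_iff : f.HasEdge d.edge ↔
    dartDir d ≠ f.axis ∧ f.HasVertex (base d) ∧ base d (dartDir d) = f.corner (dartDir d) := by
  have hup : up (base d) (dartDir d) (base_lt d) ∈ d.edge :=
    have h := isNext_up (base d) (dartDir d) (base_lt d)
    mem_edge_iff.2 ⟨.inr h.1, h.2⟩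
  have hnext := isNext_up (base d) (dartDir d) (base_lt d)
  constructor
  · intro h
    have hne : dartDir d ≠ f.axis := fun heq => by
      have h₁ := (h _ (base_mem_edge d)).1
      have h₂ := (h _ hup).1
      rw [← heq] at h₁ h₂
      exact absurd hnext.1 (by rw [h₁, h₂]; omega)
    have h₁ := (h _ (base_mem_edge d)).2 _ hne
    have h₂ := (h _ hup).2 _ hne
    have h₃ := hnext.1
    exact ⟨hne, h _ (base_mem_edge d), Fin.ext (by omega)⟩
  · rintro ⟨hne, hbase, hcorner⟩ u hu
    obtain ⟨hdir, hother⟩ := mem_edge_iff.1 hu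
    refine ⟨(hother _ hne.symm).trans hbase.1, fun k hk => ?_⟩
    obtain rfl | hkd := eq_or_ne k (dartDir d)
    · rwa [← hcorner]
    · rw [hother k hkd]
      exact hbase.2 k hk

theorem HasEdge.dartDir_ne_axis (h : f.HasEdge d.edge) : dartDir d ≠ f.axis :=
  (hasEdge_edge_iff.1 h).1

theorem hasEdge_upDart_corner {k : Fin 3} (hk : k ≠ f.axis) :
    f.HasEdge (upDart f.corner k (f.lt k hk)).edge := by
  rw [hasEdge_edge_iff, dartDir_upDart, base_upDart]
  exact ⟨hk, hasVertex_corner, rfl⟩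

theorem eq_of_hasEdge (hne : dartDir d ≠ dartDir d') (hfd : f.HasEdge d.edge)
    (hfd' : f.HasEdge d'.edge) (hgd : g.HasEdge d.edge) (hgd' : g.HasEdge d'.edge) : f = g := by
  rw [hasEdge_edge_iff] at hfd hfd' hgd hgd'
  have haxis : f.axis = g.axis := eq_of_ne_of_ne hne ⟨hfd.1.symm, hfd'.1.symm⟩
    ⟨hgd.1.symm, hgd'.1.symm⟩
  refine Face.ext haxis (funext fun j => ?_)
  by_cases hj : j = dartDir d
  · rw [hj, ← hfd.2.2, hgd.2.2]
  by_cases hj' : j = dartDir d'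
  · rw [hj', ← hfd'.2.2, hgd'.2.2]
  obtain rfl : j = f.axis := eq_of_ne_of_ne hne ⟨hj, hj'⟩ ⟨hfd.1.symm, hfd'.1.symm⟩
  rw [← hfd.2.1.1, haxis, ← hgd.2.1.1]

theorem exists_mem_edge_mem_edge (hne : dartDir d ≠ dartDir d') (hd : f.HasEdge d.edge)
    (hd' : f.HasEdge d'.edge) : ∃ u, u ∈ d.edge ∧ u ∈ d'.edge := by
  rw [hasEdge_edge_iff] at hd hd'
  have h_third (j : Fin 3) (hj : j ≠ dartDir d) (hj' : j ≠ dartDir d') : base d j = base d' j := by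
    obtain rfl : j = f.axis := eq_of_ne_of_ne hne ⟨hj, hj'⟩ ⟨hd.1.symm, hd'.1.symm⟩
    rw [hd.2.1.1, hd'.2.1.1]
  refine ⟨Function.update (base d) (dartDir d) (base d' (dartDir d)),
    mem_edge_iff.2 ⟨?_, fun l hl => by simp [hl]⟩, mem_edge_iff.2 ⟨?_, fun l hl => ?_⟩⟩
  · rw [Function.update_self, hd.2.2]
    exact hd'.2.1.2 _ hd.1
  · rw [Function.update_of_ne hne.symm, hd'.2.2]
    exact hd.2.1.2 _ hd'.1
  · obtain rfl | hld := eq_or_ne l (dartDir d)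
    · rw [Function.update_self]
    · rw [Function.update_of_ne hld, h_third l hld hl]

theorem exists_hasEdge (hne : dartDir d ≠ dartDir d') {u : Vertex n} (hu : u ∈ d.edge)
    (hu' : u ∈ d'.edge) : ∃ f : Face n, f.HasEdge d.edge ∧ f.HasEdge d'.edge := by
  obtain ⟨m, hm, hm', h_cases⟩ := exists_third hne
  rw [mem_edge_iff] at hu hu'
  have h_third : base d m = base d' m := (hu.2 m hm).symm.trans (hu'.2 m hm')
  have hdir := hu.1
  rw [hu'.2 _ hne] at hdir
  have hdir' := hu'.1
  rw [hu.2 _ hne.symm] at hdir'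
  let corner : Vertex n := Function.update (base d) (dartDir d') (base d' (dartDir d'))
  have hcorner : corner (dartDir d) = base d (dartDir d) := Function.update_of_ne hne _ _
  have hcorner' : corner (dartDir d') = base d' (dartDir d') := Function.update_self ..
  have hcorner_third : corner m = base d m := Function.update_of_ne hm' _ _
  have hlt (k : Fin 3) (hk : k ≠ m) : (corner k : ℕ) < n k := by
    obtain rfl | rfl | rfl := h_cases k
    · exact hcorner ▸ base_lt d
    · exact hcorner' ▸ base_lt d'
    · exact absurd rfl hk
  rw [← hcorner] at hdir
  rw [← hcorner'] at hdir'
  refine ⟨⟨m, corner, hlt⟩, hasEdge_edge_iff.2 ⟨hm.symm, ⟨hcorner_third.symm, fun k hk => ?_⟩,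
    hcorner.symm⟩, hasEdge_edge_iff.2 ⟨hm'.symm, ⟨h_third.symm.trans hcorner_third.symm,
      fun k hk => ?_⟩, hcorner'.symm⟩⟩
  · obtain rfl | rfl | rfl := h_cases k
    · exact .inl (congrArg Fin.val hcorner.symm)
    · exact hdir'
    · exact absurd rfl hk
  · obtain rfl | rfl | rfl := h_cases k
    · exact hdir
    · exact .inl (congrArg Fin.val hcorner'.symm)
    · exact absurd rfl hk

end Face

end Cubic

/-! ### The parity of odd faces -/

namespace Cubic

variable {n : Fin 3 → ℕ}

namespace Orientation

variable (o : Orientation n) {f : Face n} {d d' : (graph n).Dart}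

theorem pointsTo_symm_dart (d : (graph n).Dart) :
    o.pointsTo d.snd d.fst = !o.pointsTo d.fst d.snd :=
  o.pointsTo_symm _ _ d.adj

variable {o} in
theorem pointsTo_eq_of_isOddFace (hf : IsOddFace o.pointsTo f) (hfst : d.fst = d'.fst)
    (hne : dartDir d ≠ dartDir d') (hd : f.HasEdge d.edge) (hd' : f.HasEdge d'.edge) :
    o.pointsTo d.fst d.snd = o.pointsTo d'.fst d'.snd := by
  rw [Face.hasEdge_edge] at hd hd'
  have hsnd : d.snd ≠ d'.snd := fun h => hne (congrArg₂ dir hfst h)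
  have h := hf _ _ _ hd.2 hd.1 hd'.2 d.adj.symm (hfst ▸ d'.adj) hsnd
  rw [pointsTo_symm_dart, hfst, pointsTo_symm_dart] at h
  rw [hfst]
  exact Bool.not_inj h

variable {o} in
theorem pointsTo_eq_not_of_isEvenFace (hf : IsEvenFace o.pointsTo f) (hfst : d.fst = d'.fst)
    (hne : dartDir d ≠ dartDir d') (hd : f.HasEdge d.edge) (hd' : f.HasEdge d'.edge) :
    o.pointsTo d.fst d.snd = !o.pointsTo d'.fst d'.snd := by
  rw [Face.hasEdge_edge] at hd hd'
  have hsnd : d.snd ≠ d'.snd := fun h => hne (congrArg₂ dir hfst h)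
  have h := hf _ _ _ hd.2 hd.1 hd'.2 d.adj.symm (hfst ▸ d'.adj) hsnd
  rw [pointsTo_symm_dart, hfst] at h
  rw [hfst, ← h, Bool.not_not]

theorem isOddFace_iff_pointsTo_eq (hfst : d.fst = d'.fst) (hne : dartDir d ≠ dartDir d')
    (hd : f.HasEdge d.edge) (hd' : f.HasEdge d'.edge) :
    IsOddFace o.pointsTo f ↔ o.pointsTo d.fst d.snd = o.pointsTo d'.fst d'.snd := by
  refine ⟨fun hf => pointsTo_eq_of_isOddFace hf hfst hne hd hd', fun h => ?_⟩
  refine (o.even_or_odd f).resolve_left fun hf => ?_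
  rw [pointsTo_eq_not_of_isEvenFace hf hfst hne hd hd'] at h
  exact Bool.not_ne_self _ h

theorem isOddFace_iff_pointsTo_corner {k l : Fin 3} (hk : k ≠ f.axis) (hl : l ≠ f.axis)
    (hkl : k ≠ l) : IsOddFace o.pointsTo f ↔
      o.pointsTo f.corner (up f.corner k (f.lt k hk)) =
        o.pointsTo f.corner (up f.corner l (f.lt l hl)) :=
  o.isOddFace_iff_pointsTo_eq (d := upDart f.corner k (f.lt k hk))
    (d' := upDart f.corner l (f.lt l hl)) rfl (by simpa only [dartDir_upDart])
    (Face.hasEdge_upDart_corner hk) (Face.hasEdge_upDart_corner hl)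

theorem isEvenFace_iff_not_isOddFace : IsEvenFace o.pointsTo f ↔ ¬ IsOddFace o.pointsTo f := by
  refine ⟨fun h_even h_odd => ?_, (o.even_or_odd f).resolve_right⟩
  have h₁ : f.axis + 1 ≠ f.axis := by simp
  have h₂ : f.axis + 2 ≠ f.axis := by simp
  have hne : dartDir (upDart f.corner _ (f.lt _ h₁)) ≠ dartDir (upDart f.corner _ (f.lt _ h₂)) := by
    simp [dartDir_upDart]
  have hd₁ := Face.hasEdge_upDart_corner h₁
  have hd₂ := Face.hasEdge_upDart_corner h₂
  have h := pointsTo_eq_of_isOddFace h_odd (show f.corner = f.corner from rfl) hne hd₁ hd₂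
  exact Bool.self_ne_not _ (h.symm.trans (pointsTo_eq_not_of_isEvenFace h_even rfl hne hd₁ hd₂))

theorem pointsTo_opposite {u v u' v' : Vertex n} (huv : (graph n).Adj u v)
    (huv' : (graph n).Adj u' v') (huu' : (graph n).Adj u u')
    (hne : v ≠ u') (hne' : u ≠ v') (hu : f.HasVertex u) (hv : f.HasVertex v) (hu' : f.HasVertex u')
    (hv' : f.HasVertex v') : o.pointsTo u' v' = !o.pointsTo u v := by
  rw [← o.pointsTo_symm u v huv]
  obtain hf | hf := o.even_or_odd f
  · rw [hf v u u' hv hu hu' huv.symm huu' hne, hf u u' v' hu hu' hv' huu' huv' hne']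
  · rw [hf v u u' hv hu hu' huv.symm huu' hne, o.pointsTo_symm v' u' huv'.symm,
      ← hf u u' v' hu hu' hv' huu' huv' hne', o.pointsTo_symm u u' huu']

theorem pointsTo_up_of_isNext {j k : Fin 3} (hjk : j ≠ k) {v w : Vertex n} (hvw : IsNext j v w)
    (hv : (v k : ℕ) < n k) (hw : (w k : ℕ) < n k) :
    o.pointsTo w (up w k hw) = !o.pointsTo v (up v k hv) := by
  obtain ⟨m, hmj, hmk, h_cases⟩ := exists_third hjk
  have hwk : w k = v k := hvw.2 k hjk.symm
  have hvj : (v j : ℕ) < n j := by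
    have := (w j).isLt
    have := hvw.1
    omega
  let f : Face n := ⟨m, v, fun i hi => by obtain rfl | rfl | rfl := h_cases i <;> trivial⟩
  have hfv : f.HasEdge (upDart v k hv).edge := Face.hasEdge_upDart_corner (f := f) hmk.symm
  have hfw : f.HasEdge (upDart w k hw).edge := by
    rw [Face.hasEdge_edge_iff, dartDir_upDart, base_upDart]
    refine ⟨hmk.symm, ⟨hvw.2 m hmj, fun i hi => ?_⟩, hwk⟩
    obtain rfl | rfl | rfl := h_cases i
    exacts [.inr hvw.1, .inl (congrArg Fin.val hwk), absurd rfl hi]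
  have hne : v j ≠ w j := fun h => absurd hvw.1 (by rw [h]; omega)
  rw [Face.hasEdge_edge] at hfv hfw
  exact o.pointsTo_opposite (upDart v k hv).adj (upDart w k hw).adj ⟨j, .inl hvw⟩
    (fun h => hne (by rw [← h]; simp [up, hjk])) (fun h => hne (by rw [h]; simp [up, hjk]))
    hfv.1 hfv.2 hfw.1 hfw.2

theorem isOddFace_iff_of_isNext_axis {f g : Face n} (haxis : f.axis = g.axis)
    (hnext : IsNext f.axis f.corner g.corner) :
    IsOddFace o.pointsTo f ↔ IsOddFace o.pointsTo g := by
  have h₁ : f.axis + 1 ≠ f.axis := by simp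
  have h₂ : f.axis + 2 ≠ f.axis := by simp
  have h₁₂ : f.axis + 1 ≠ f.axis + 2 := by simp
  rw [o.isOddFace_iff_pointsTo_corner h₁ h₂ h₁₂,
    o.isOddFace_iff_pointsTo_corner (f := g) (haxis ▸ h₁) (haxis ▸ h₂) h₁₂,
    o.pointsTo_up_of_isNext h₁.symm hnext (f.lt _ h₁),
    o.pointsTo_up_of_isNext h₂.symm hnext (f.lt _ h₂), Bool.not_inj_iff]

theorem isOddFace_iff_not_of_adjInSlice {f g : Face n} (h : f.AdjInSlice g) :
    IsOddFace o.pointsTo f ↔ ¬ IsOddFace o.pointsTo g := by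
  rw [o.checkerboard f g h, isEvenFace_iff_not_isOddFace]

end Orientation

/-- The parities `a` determine the odd faces of `o`: a face is odd if and only if the two
coordinates of its corner that vary along the face, shifted by `a`, have the same parity. -/
def IsParity (o : Orientation n) (a : Fin 3 → ℕ) : Prop :=
  ∀ (f : Face n) (k l : Fin 3), k ≠ f.axis → l ≠ f.axis → k ≠ l →
    (IsOddFace o.pointsTo f ↔ (f.corner k + a k) % 2 = (f.corner l + a l) % 2)

theorem IsNext.lt {k : Fin 3} {v w : Vertex n} (h : IsNext k v w) : v < w := by
  refine Pi.lt_def.2 ⟨fun l => ?_, k, Fin.lt_def.2 (h.1 ▸ Nat.lt_succ_self _)⟩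
  obtain rfl | hl := eq_or_ne l k
  · exact Fin.le_def.2 (h.1 ▸ Nat.le_succ _)
  · exact (h.2 l hl).ge

theorem Face.exists_isNext_corner {f : Face n} {j : Fin 3} (hj : f.corner j ≠ 0) :
    ∃ g : Face n, g.axis = f.axis ∧ IsNext j g.corner f.corner := by
  have hpos : (f.corner j : ℕ) ≠ 0 := fun h => hj (Fin.ext h)
  let v : Vertex n := Function.update f.corner j ⟨f.corner j - 1, by omega⟩
  have hv : IsNext j v f.corner := ⟨by simp [v]; omega, fun l hl => by simp [v, hl]⟩
  exact ⟨⟨f.axis, v, fun k hk => lt_of_le_of_lt (hv.lt.le k) (f.lt k hk)⟩, rfl, hv⟩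

theorem exists_isParity (o : Orientation n) : ∃ a, IsParity o a := by
  let a (k : Fin 3) : ℕ := if h : 0 < n k then (o.pointsTo 0 (up 0 k h)).toNat else 0
  refine ⟨a, fun f => ?_⟩
  induction hv : f.corner using WellFoundedLT.induction generalizing f with | ind v ih =>
  intro k l hk hl hkl
  subst hv
  by_cases hzero : f.corner = 0
  · obtain ⟨m, v, hlt⟩ := f
    obtain rfl : v = 0 := hzero
    have ha (j : Fin 3) (hj : j ≠ m) : a j = (o.pointsTo 0 (up 0 j (hlt j hj))).toNat :=
      dif_pos (hlt j hj)
    rw [o.isOddFace_iff_pointsTo_corner hk hl hkl, ha k hk, ha l hl]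
    have h_mod (b c : Bool) : b = c ↔ (0 + b.toNat) % 2 = (0 + c.toNat) % 2 := by
      revert b c; decide
    exact h_mod _ _
  · obtain ⟨j, hj⟩ := Function.ne_iff.1 hzero
    obtain ⟨g, haxis, hnext⟩ := Face.exists_isNext_corner hj
    have hg := ih g.corner hnext.lt g rfl k l (haxis ▸ hk) (haxis ▸ hl) hkl
    have hcoord (i : Fin 3) : (f.corner i : ℕ) = g.corner i + if i = j then 1 else 0 := by
      split_ifs with hi
      exacts [hi ▸ hnext.1, congrArg Fin.val (hnext.2 i hi)]
    by_cases hja : j = f.axis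
    · subst hja
      rw [← o.isOddFace_iff_of_isNext_axis haxis (haxis ▸ hnext), hg, hcoord k, hcoord l,
        if_neg hk, if_neg hl, add_zero, add_zero]
    · rw [o.isOddFace_iff_not_of_adjInSlice ⟨haxis.symm, j, hja, .inr hnext⟩, hg, hcoord k,
        hcoord l]
      obtain rfl | rfl : j = k ∨ j = l := by
        by_contra! h
        exact hja (eq_of_ne_of_ne hkl h ⟨hk.symm, hl.symm⟩)
      · rw [if_pos rfl, if_neg hkl.symm]; omega
      · rw [if_pos rfl, if_neg hkl]; omega

namespace IsParity

variable {o : Orientation n} {a : Fin 3 → ℕ}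

theorem isOddFace_iff (ha : IsParity o a) {f : Face n} {d d' : (graph n).Dart}
    (hne : dartDir d ≠ dartDir d') (hd : f.HasEdge d.edge) (hd' : f.HasEdge d'.edge) :
    IsOddFace o.pointsTo f ↔
      (base d (dartDir d) + a (dartDir d)) % 2 = (base d' (dartDir d') + a (dartDir d')) % 2 := by
  rw [Face.hasEdge_edge_iff] at hd hd'
  rw [ha f _ _ hd.1 hd'.1 hne, hd.2.2, hd'.2.2]

end IsParity

theorem exists_along {l : Fin 3} (hl : 0 < n l) (v : Vertex n) : ∃ w, Along l v w := by
  by_cases h : (v l : ℕ) < n l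
  · exact ⟨up v l h, .inl (isNext_up v l h)⟩
  · exact ⟨Function.update v l ⟨v l - 1, by omega⟩,
      .inr ⟨by simp; omega, fun j hj => by simp [hj]⟩⟩

theorem Orientation.pointsTo_collinear (o : Orientation n) {k l : Fin 3} (hlk : l ≠ k)
    (hl : 0 < n l) {u v w : Vertex n} (hu : Along k v u) (hw : Along k v w) (huw : u ≠ w) :
    o.pointsTo v u = !o.pointsTo v w := by
  obtain ⟨a, ha⟩ := exists_isParity o
  obtain ⟨x, hx⟩ := exists_along hl v
  let d : (graph n).Dart := ⟨(v, u), k, hu⟩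
  let d' : (graph n).Dart := ⟨(v, w), k, hw⟩
  let e : (graph n).Dart := ⟨(v, x), l, hx⟩
  have hd : dartDir d = k := hu.dir_eq
  have hd' : dartDir d' = k := hw.dir_eq
  have he : dartDir e = l := hx.dir_eq
  have hne : dartDir d ≠ dartDir e := by rw [hd, he]; exact hlk.symm
  have hne' : dartDir d' ≠ dartDir e := by rw [hd', he]; exact hlk.symm
  obtain ⟨f, hfd, hfe⟩ := Face.exists_hasEdge hne (Sym2.mem_mk_left v u) (Sym2.mem_mk_left v x)
  obtain ⟨g, hgd, hge⟩ := Face.exists_hasEdge hne' (Sym2.mem_mk_left v w) (Sym2.mem_mk_left v x)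
  have h_base : (base d k + a k) % 2 ≠ (base d' k + a k) % 2 := by
    have hk : u k ≠ w k := fun h => huw <| funext fun j => by
      obtain rfl | hj := eq_or_ne j k
      exacts [h, (hu.eq_of_ne hj).symm.trans (hw.eq_of_ne hj)]
    have hu' := hu.imp And.left And.left
    have hw' := hw.imp And.left And.left
    simp only [base, d, d', Fin.coe_min]
    omega
  have hf := ha.isOddFace_iff hne hfd hfe
  have hg := ha.isOddFace_iff hne' hgd hge
  rw [o.isOddFace_iff_pointsTo_eq (show d.fst = e.fst from rfl) hne hfd hfe, hd, he] at hf
  rw [o.isOddFace_iff_pointsTo_eq (show d'.fst = e.fst from rfl) hne' hgd hge, hd', he] at hg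
  have h_iff : o.pointsTo v u = o.pointsTo v x ↔ o.pointsTo v w ≠ o.pointsTo v x := by
    rw [ne_eq, hf, hg]
    omega
  revert h_iff
  cases o.pointsTo v u <;> cases o.pointsTo v w <;> cases o.pointsTo v x <;> decide

end Cubic

/-! ### Odd cells and isolated odd faces -/

namespace Cubic

variable {n : Fin 3 → ℕ}

theorem Face.isFaceOf_iff {f : Face n} {c : Cell n} :
    f.IsFaceOf c ↔ (∀ j, j ≠ f.axis → (f.corner j : ℕ) = c j) ∧
      ((f.corner f.axis : ℕ) = c f.axis ∨ (f.corner f.axis : ℕ) = c f.axis + 1) := by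
  constructor
  · rintro ⟨k, rfl | rfl⟩
    · exact ⟨fun j _ => rfl, .inl rfl⟩
    · refine ⟨fun j (hj : j ≠ k) => ?_, .inr ?_⟩ <;> simp_all [Cell.upper]
  · rintro ⟨h, h_axis | h_axis⟩
    · refine ⟨f.axis, .inl (Face.ext_val rfl fun j => ?_)⟩
      obtain rfl | hj := eq_or_ne j f.axis
      exacts [h_axis, h j hj]
    · refine ⟨f.axis, .inr (Face.ext_val rfl fun j => ?_)⟩
      obtain rfl | hj := eq_or_ne j f.axis
      · simpa [Cell.upper] using h_axis
      · simpa [Cell.upper, hj] using h j hj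

namespace Cell

/-- `c.HasEdge e`: both ends of `e` are vertices of the cell `c`. -/
def HasEdge (c : Cell n) (e : Sym2 (Vertex n)) : Prop :=
  ∀ u ∈ e, ∀ j, (u j : ℕ) = c j ∨ (u j : ℕ) = c j + 1

theorem hasEdge_edge_iff {c : Cell n} {d : (graph n).Dart} :
    c.HasEdge d.edge ↔ (base d (dartDir d) : ℕ) = c (dartDir d) ∧
      ∀ l, l ≠ dartDir d → (base d l : ℕ) = c l ∨ (base d l : ℕ) = c l + 1 := by
  simp only [HasEdge, mem_edge_iff]
  constructor
  · intro h
    have h_base := h (base d) ⟨.inl rfl, fun _ _ => rfl⟩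
    refine ⟨?_, fun l _ => h_base l⟩
    have h_up := h (up (base d) (dartDir d) (base_lt d))
      ⟨.inr (by simp [up]), fun l hl => by simp [up, hl]⟩ (dartDir d)
    have := h_base (dartDir d)
    simp only [up, Function.update_self] at h_up
    omega
  · rintro ⟨hk, hl⟩ u ⟨huk, hul⟩ j
    obtain rfl | hj := eq_or_ne j (dartDir d)
    · omega
    · exact hul j hj ▸ hl j hj

end Cell

theorem Face.IsFaceOf.hasEdge_iff {f : Face n} {c : Cell n} (h : f.IsFaceOf c)
    {d : (graph n).Dart} : f.HasEdge d.edge ↔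
      c.HasEdge d.edge ∧ dartDir d ≠ f.axis ∧ base d f.axis = f.corner f.axis := by
  obtain ⟨h_eq, h_axis⟩ := Face.isFaceOf_iff.1 h
  rw [Face.hasEdge_edge_iff, Cell.hasEdge_edge_iff]
  constructor
  · rintro ⟨h_dir, ⟨h_base, h_ne⟩, h_corner⟩
    refine ⟨⟨h_corner ▸ h_eq _ h_dir, fun l hl => ?_⟩, h_dir, h_base⟩
    obtain rfl | hla := eq_or_ne l f.axis
    · exact h_base ▸ h_axis
    · exact h_eq l hla ▸ h_ne l hla
  · rintro ⟨⟨h_eq_dir, h_ne⟩, h_dir, h_base⟩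
    have h_corner := h_eq _ h_dir
    refine ⟨h_dir, ⟨h_base, fun l hl => ?_⟩, Fin.ext (by omega)⟩
    have := h_eq l hl
    obtain rfl | hld := eq_or_ne l (dartDir d)
    · exact .inl (by omega)
    · have := h_ne l hld
      omega

theorem Cell.HasEdge.exists_isFaceOf {c : Cell n} {d : (graph n).Dart} (h : c.HasEdge d.edge)
    {l : Fin 3} (hl : l ≠ dartDir d) :
    ∃ f : Face n, f.IsFaceOf c ∧ f.axis = l ∧ f.HasEdge d.edge := by
  obtain h_base | h_base := (hasEdge_edge_iff.1 h).2 l hl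
  · exact ⟨c.lower l, ⟨l, .inl rfl⟩, rfl,
      (Face.IsFaceOf.hasEdge_iff ⟨l, .inl rfl⟩).2 ⟨h, hl.symm, Fin.ext h_base⟩⟩
  · exact ⟨c.upper l, ⟨l, .inr rfl⟩, rfl, (Face.IsFaceOf.hasEdge_iff ⟨l, .inr rfl⟩).2
      ⟨h, hl.symm, Fin.ext (by simpa [upper] using h_base)⟩⟩

namespace IsParity

variable {o : Orientation n} {a : Fin 3 → ℕ} {f g : Face n} {c c' : Cell n} {d : (graph n).Dart}

theorem isOddCell_iff (ha : IsParity o a) :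
    IsOddCell o c ↔ ∀ k l, (c k + a k) % 2 = (c l + a l) % 2 := by
  constructor
  · intro h k l
    obtain rfl | hkl := eq_or_ne k l
    · rfl
    · obtain ⟨m, hmk, hml, -⟩ := exists_third hkl
      exact (ha (c.lower m) k l hmk.symm hml.symm hkl).1 (h _ ⟨m, .inl rfl⟩)
  · intro h f hf
    have h_corner := (Face.isFaceOf_iff.1 hf).1
    have h₁ : f.axis + 1 ≠ f.axis := by simp
    have h₂ : f.axis + 2 ≠ f.axis := by simp
    rw [ha f _ _ h₁ h₂ (by simp), h_corner _ h₁, h_corner _ h₂]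
    exact h _ _

theorem isFaceOf_of_hasEdge (ha : IsParity o a) (hc : IsOddCell o c)
    (hcd : c.HasEdge d.edge) (hf : IsOddFace o.pointsTo f) (hfd : f.HasEdge d.edge) :
    f.IsFaceOf c := by
  rw [Cell.hasEdge_edge_iff] at hcd
  rw [Face.hasEdge_edge_iff] at hfd
  obtain ⟨hdir, ⟨h_axis, h_base⟩, h_dir⟩ := hfd
  rw [Face.isFaceOf_iff, ← h_axis]
  refine ⟨fun j hj => ?_, hcd.2 _ hdir.symm⟩
  obtain rfl | hjd := eq_or_ne j (dartDir d)
  · rw [← h_dir, hcd.1]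
  · have h_face := (ha f _ j hdir hj hjd.symm).1 hf
    have h_cell := ha.isOddCell_iff.1 hc (dartDir d) j
    have := hcd.2 j hjd
    have := h_base j hj
    rw [← h_dir, hcd.1] at h_face
    omega

theorem exists_isOddCell_isFaceOf (ha : IsParity o a) (hf : IsOddFace o.pointsTo f)
    (t : Fin (n f.axis)) (ht : (f.corner f.axis : ℕ) = t ∨ (f.corner f.axis : ℕ) = t + 1)
    {k : Fin 3} (hk : k ≠ f.axis) (hat : (t + a f.axis) % 2 = (f.corner k + a k) % 2) :
    ∃ c, IsOddCell o c ∧ f.IsFaceOf c := by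
  let c : Cell n := fun j => if h : j = f.axis then h ▸ t else ⟨f.corner j, f.lt j h⟩
  have h_axis : c f.axis = t := dif_pos rfl
  have h_ne (j : Fin 3) (hj : j ≠ f.axis) : (c j : ℕ) = f.corner j :=
    congrArg Fin.val (dif_neg hj)
  refine ⟨c, ha.isOddCell_iff.2 ?_, Face.isFaceOf_iff.2
    ⟨fun j hj => (h_ne j hj).symm, by rwa [h_axis]⟩⟩
  have h_all (j : Fin 3) : (c j + a j) % 2 = (f.corner k + a k) % 2 := by
    obtain rfl | hj := eq_or_ne j f.axis
    · rw [h_axis, hat]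
    · rw [h_ne j hj]
      obtain rfl | hjk := eq_or_ne j k
      exacts [rfl, (ha f j k hj hk hjk).1 hf]
  exact fun i j => (h_all i).trans (h_all j).symm

theorem isIsolatedOddFace_or_exists_isOddCell (ha : IsParity o a) (hf : IsOddFace o.pointsTo f) :
    IsIsolatedOddFace o f ∨ ∃ c, IsOddCell o c ∧ f.IsFaceOf c := by
  by_cases hb : f.IsBoundary
  · by_cases h : ∃ c, IsOddCell o c ∧ f.IsFaceOf c
    · exact .inr h
    · exact .inl ⟨hf, hb, fun c hc hfc => h ⟨c, hc, hfc⟩⟩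
  · right
    obtain ⟨k, hk⟩ := exists_ne f.axis
    have hlt := (f.corner f.axis).isLt
    unfold Face.IsBoundary at hb
    by_cases h : (f.corner f.axis + a f.axis) % 2 = (f.corner k + a k) % 2
    · exact ha.exists_isOddCell_isFaceOf hf ⟨f.corner f.axis, by omega⟩ (.inl rfl) hk h
    · exact ha.exists_isOddCell_isFaceOf hf ⟨f.corner f.axis - 1, by omega⟩ (.inr (by simp; omega))
        hk (by simp; omega)

theorem eq_of_axis_eq (ha : IsParity o a) (hf : IsOddFace o.pointsTo f)
    (hg : IsOddFace o.pointsTo g) (h_axis : f.axis = g.axis) (hfd : f.HasEdge d.edge)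
    (hgd : g.HasEdge d.edge) : f = g := by
  rw [Face.hasEdge_edge_iff] at hfd hgd
  obtain ⟨hdf, ⟨hf_axis, hf_base⟩, hf_dir⟩ := hfd
  obtain ⟨hdg, ⟨hg_axis, hg_base⟩, hg_dir⟩ := hgd
  have h_dir := hf_dir.symm.trans hg_dir
  refine Face.ext_val h_axis fun j => ?_
  obtain rfl | hjf := eq_or_ne j f.axis
  · rw [← hf_axis, h_axis, hg_axis]
  obtain rfl | hjd := eq_or_ne j (dartDir d)
  · rw [h_dir]
  have hjg := h_axis ▸ hjf
  have h_odd_f := (ha f j _ hjf hdf hjd).1 hf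
  have h_odd_g := (ha g j _ hjg hdg hjd).1 hg
  have := hf_base j hjf
  have := hg_base j hjg
  rw [h_dir] at h_odd_f
  omega

theorem eq_of_isIsolatedOddFace (ha : IsParity o a) (hf : IsIsolatedOddFace o f)
    (hg : IsOddFace o.pointsTo g) (hfd : f.HasEdge d.edge) (hgd : g.HasEdge d.edge) : f = g := by
  by_cases h_axis : f.axis = g.axis
  · exact ha.eq_of_axis_eq hf.1 hg h_axis hfd hgd
  · rw [Face.hasEdge_edge_iff] at hfd hgd
    obtain ⟨hdf, ⟨hf_axis, -⟩, hf_dir⟩ := hfd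
    obtain ⟨hdg, ⟨-, hg_base⟩, hg_dir⟩ := hgd
    have h_odd := (ha g _ _ h_axis hdg hdf.symm).1 hg
    obtain ⟨c, hc, hfc⟩ := ha.exists_isOddCell_isFaceOf hf.1 ⟨g.corner f.axis, g.lt _ h_axis⟩
      (hf_axis ▸ hg_base _ h_axis) hdf (hf_dir.symm.trans hg_dir ▸ h_odd)
    exact absurd hfc (hf.2.2 c hc)

theorem isFaceOf_iff_exists_hasEdge (ha : IsParity o a) (hc : IsOddCell o c) (hf : f.IsFaceOf c)
    (hg : IsOddFace o.pointsTo g) (h_axis : f.axis ≠ g.axis) :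
    g.IsFaceOf c ↔ ∃ d : (graph n).Dart, f.HasEdge d.edge ∧ g.HasEdge d.edge := by
  refine ⟨fun hgc => ?_, fun ⟨d, hfd, hgd⟩ =>
    ha.isFaceOf_of_hasEdge hc (hf.hasEdge_iff.1 hfd).1 hg hgd⟩
  obtain ⟨m, hmf, hmg, h_cases⟩ := exists_third h_axis
  let v : Vertex n := Function.update f.corner g.axis (g.corner g.axis)
  have hv : v m = f.corner m := Function.update_of_ne hmg _ _
  have hvf : v f.axis = f.corner f.axis := Function.update_of_ne h_axis _ _
  have hvg : v g.axis = g.corner g.axis := Function.update_self ..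
  obtain ⟨hf_eq, hf_axis⟩ := Face.isFaceOf_iff.1 hf
  have hg_axis := (Face.isFaceOf_iff.1 hgc).2
  let d := upDart v m (hv ▸ f.lt m hmf)
  have h_dir : dartDir d = m := dartDir_upDart ..
  have h_base : base d = v := base_upDart ..
  have h_cell : c.HasEdge d.edge := by
    rw [Cell.hasEdge_edge_iff, h_dir, h_base, hv]
    refine ⟨hf_eq m hmf, fun l hl => ?_⟩
    obtain rfl | rfl | rfl := h_cases l
    exacts [hvf ▸ hf_axis, hvg ▸ hg_axis, absurd rfl hl]
  exact ⟨d, hf.hasEdge_iff.2 ⟨h_cell, h_dir ▸ hmf, h_base ▸ hvf⟩,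
    hgc.hasEdge_iff.2 ⟨h_cell, h_dir ▸ hmg, h_base ▸ hvg⟩⟩

theorem isOddCell_unique (ha : IsParity o a) (hc : IsOddCell o c) (hc' : IsOddCell o c')
    (hf : f.IsFaceOf c) (hf' : f.IsFaceOf c') : c = c' := by
  rw [Face.isFaceOf_iff] at hf hf'
  obtain ⟨k, hk⟩ := exists_ne f.axis
  have h := ha.isOddCell_iff.1 hc k f.axis
  have h' := ha.isOddCell_iff.1 hc' k f.axis
  rw [← hf.1 k hk] at h
  rw [← hf'.1 k hk] at h'
  refine funext fun j => Fin.ext ?_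
  obtain rfl | hj := eq_or_ne j f.axis
  · omega
  · rw [← hf.1 j hj, ← hf'.1 j hj]

end IsParity

end Cubic

/-! ### The relations between the encoded operators -/

namespace Cubic

open Pauli

variable {n : Fin 3 → ℕ} (o : Orientation n)

theorem vertexOp_eq (v : Vertex n) : vertexOp o v = word (single (.inl v) 2) := by
  unfold vertexOp word single
  congr! 2
  split_ifs <;> rfl

/-- The Pauli matrix with which the operator of the edge of `d` acts on each qubit. -/
def edgeLabel (d : (graph n).Dart) : Qubit o → Option (Fin 3)
  | .inl u =>
    if u = d.fst then some (if o.pointsTo d.fst d.snd then 0 else 1)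
    else if u = d.snd then some (if o.pointsTo d.snd d.fst then 0 else 1) else none
  | .inr f => if f.1.HasEdge d.edge then some (dartDir d) else none

theorem rawEdgeOp_eq {d : (graph n).Dart} (h : o.pointsTo d.fst d.snd) :
    rawEdgeOp o d.fst d.snd = word (edgeLabel o d) := by
  unfold rawEdgeOp word
  congr! 2 with q
  obtain u | f := q
  · simp only [edgeLabel, o.pointsTo_symm_dart, h, Bool.not_true, if_true, Bool.false_eq_true,
      if_false]
    split_ifs <;> rfl
  · simp only [edgeLabel, Face.hasEdge_edge]
    split_ifs <;> rfl

theorem edgeLabel_symm (d : (graph n).Dart) : edgeLabel o d.symm = edgeLabel o d := by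
  funext q
  obtain u | f := q
  · exact ite_ite_comm (P := u = d.snd) (Q := u = d.fst) _ _
      fun hsnd hfst => d.adj.ne (hfst.symm.trans hsnd)
  · simp only [edgeLabel, SimpleGraph.Dart.edge_symm, dartDir_symm]

variable {o} {d d' : (graph n).Dart}

theorem edgeLabel_congr (h : d.edge = d'.edge) : edgeLabel o d = edgeLabel o d' := by
  obtain rfl | rfl := (SimpleGraph.dart_edge_eq_iff _ _).1 h
  exacts [rfl, edgeLabel_symm o d']

theorem edgeLabel_fst :
    edgeLabel o d (.inl d.fst) = some (if o.pointsTo d.fst d.snd then 0 else 1) :=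
  if_pos rfl

theorem edgeLabel_inl_of_notMem {u : Vertex n} (hu : u ∉ d.edge) :
    edgeLabel o d (.inl u) = none := by
  rw [SimpleGraph.Dart.edge, Sym2.mem_iff, not_or] at hu
  exact (if_neg hu.1).trans (if_neg hu.2)

theorem edgeLabel_inr (f : OddFace o) :
    edgeLabel o d (.inr f) = if f.1.HasEdge d.edge then some (dartDir d) else none := rfl

section Commutation

theorem commSign_edgeLabel_vertex (v : Vertex n) :
    commSign (edgeLabel o d (.inl v)) (some 2) = if v ∈ d.edge then -1 else 1 := by
  split_ifs with hv
  · simp only [edgeLabel]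
    obtain rfl | rfl := Sym2.mem_iff.1 hv <;> split_ifs <;> simp_all [commSign_some_some]
  · rw [edgeLabel_inl_of_notMem hv, commSign_none_left]

theorem commSign_edgeLabel_inl {u : Vertex n} (hu : ¬ (u ∈ d.edge ∧ u ∈ d'.edge)) :
    commSign (edgeLabel o d (.inl u)) (edgeLabel o d' (.inl u)) = 1 := by
  obtain hu | hu := not_and_or.1 hu
  · rw [edgeLabel_inl_of_notMem hu, commSign_none_left]
  · rw [edgeLabel_inl_of_notMem hu, commSign_none_right]

theorem commSign_edgeLabel_fst (h : d.fst = d'.fst) :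
    commSign (edgeLabel o d (.inl d.fst)) (edgeLabel o d' (.inl d.fst)) =
      if o.pointsTo d.fst d.snd = o.pointsTo d'.fst d'.snd then 1 else -1 := by
  rw [edgeLabel_fst, h, edgeLabel_fst, ← h]
  cases o.pointsTo d.fst d.snd <;> cases o.pointsTo d.fst d'.snd <;> rfl

theorem commSign_edgeLabel_inr (f : OddFace o) :
    commSign (edgeLabel o d (.inr f)) (edgeLabel o d' (.inr f)) =
      if f.1.HasEdge d.edge ∧ f.1.HasEdge d'.edge ∧ dartDir d ≠ dartDir d' then -1 else 1 := by
  by_cases hd : f.1.HasEdge d.edge <;> by_cases hd' : f.1.HasEdge d'.edge <;>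
    by_cases hdir : dartDir d = dartDir d' <;>
    simp [edgeLabel_inr, hd, hd', hdir, commSign_none_left, commSign_none_right,
      commSign_some_some]

theorem word_edgeLabel_mul_of_disjoint (h : ∀ u ∈ d.edge, u ∉ d'.edge) :
    word (edgeLabel o d) * word (edgeLabel o d') =
      word (edgeLabel o d') * word (edgeLabel o d) := by
  rw [word_mul_word, Finset.prod_eq_one, one_smul]
  rintro (u | f) -
  · exact commSign_edgeLabel_inl fun hu => h u hu.1 hu.2
  · rw [commSign_edgeLabel_inr, if_neg]
    rintro ⟨hd, hd', hdir⟩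
    obtain ⟨u, hu, hu'⟩ := Face.exists_mem_edge_mem_edge hdir hd hd'
    exact h u hu hu'

theorem prod_commSign_edgeLabel_inl (h : d.fst = d'.fst) (hsnd : d.snd ≠ d'.snd) :
    ∏ u, commSign (edgeLabel o d (.inl u)) (edgeLabel o d' (.inl u)) =
      if o.pointsTo d.fst d.snd = o.pointsTo d'.fst d'.snd then 1 else -1 := by
  rw [← commSign_edgeLabel_fst h]
  refine Fintype.prod_eq_single _ fun u hu => commSign_edgeLabel_inl ?_
  rintro ⟨hud, hud'⟩
  have hd := (Sym2.mem_iff.1 hud).resolve_left hu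
  have hd' := (Sym2.mem_iff.1 hud').resolve_left (h ▸ hu)
  exact hsnd (hd.symm.trans hd')

theorem prod_commSign_edgeLabel_inr (h : d.fst = d'.fst) :
    ∏ f, commSign (edgeLabel o d (.inr f)) (edgeLabel o d' (.inr f)) =
      if dartDir d ≠ dartDir d' ∧ o.pointsTo d.fst d.snd = o.pointsTo d'.fst d'.snd then -1
      else 1 := by
  simp only [commSign_edgeLabel_inr]
  by_cases hdir : dartDir d = dartDir d'
  · simp [hdir]
  obtain ⟨f, hf, hf'⟩ := Face.exists_hasEdge hdir (Sym2.mem_mk_left d.fst d.snd)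
    (h ▸ Sym2.mem_mk_left d'.fst d'.snd)
  have h_unique (g : OddFace o) (hg : g.1.HasEdge d.edge ∧ g.1.HasEdge d'.edge ∧
      dartDir d ≠ dartDir d') : g.1 = f := Face.eq_of_hasEdge hdir hg.1 hg.2.1 hf hf'
  have h_odd := o.isOddFace_iff_pointsTo_eq h hdir hf hf'
  by_cases hodd : IsOddFace o.pointsTo f
  · rw [if_pos ⟨hdir, h_odd.1 hodd⟩, Fintype.prod_eq_single (⟨f, hodd⟩ : OddFace o),
      if_pos ⟨hf, hf', hdir⟩]
    exact fun g hg => if_neg fun h => hg (Subtype.ext (h_unique g h))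
  · rw [if_neg fun h => hodd (h_odd.2 h.2)]
    exact Finset.prod_eq_one fun g _ => if_neg fun h => hodd (h_unique g h ▸ g.2)

theorem prod_commSign_edgeLabel (hn : ∀ k, ∃ l, l ≠ k ∧ 0 < n l) (h : d.fst = d'.fst)
    (hsnd : d.snd ≠ d'.snd) :
    ∏ q, commSign (edgeLabel o d q) (edgeLabel o d' q) = -1 := by
  rw [Fintype.prod_sum_type, prod_commSign_edgeLabel_inl h hsnd, prod_commSign_edgeLabel_inr h]
  by_cases hdir : dartDir d = dartDir d'
  · obtain ⟨l, hl, hpos⟩ := hn (dartDir d)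
    have := o.pointsTo_collinear hl hpos (along_dartDir d) (h ▸ hdir ▸ along_dartDir d') hsnd
    simp [hdir, ← h, this]
  · by_cases hp : o.pointsTo d.fst d.snd = o.pointsTo d'.fst d'.snd <;> simp [hdir, hp]

theorem word_edgeLabel_mul_of_snd_eq_fst (hn : ∀ k, ∃ l, l ≠ k ∧ 0 < n l) (h : d.snd = d'.fst)
    (h' : d.fst ≠ d'.snd) :
    word (edgeLabel o d) * word (edgeLabel o d') =
      -(word (edgeLabel o d') * word (edgeLabel o d)) := by
  rw [← edgeLabel_symm o d, word_mul_word, prod_commSign_edgeLabel hn (d := d.symm) h h',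
    Units.neg_smul, one_smul]

end Commutation

section Operators

variable (o) (χ : EdgeChoice o)

/-- The sign that compares the direction of a directed edge with the orientation. -/
def directionSign (d : (graph n).Dart) : ℤˣ := if o.pointsTo d.fst d.snd then 1 else -1

theorem directionSign_symm (d : (graph n).Dart) : directionSign o d.symm = -directionSign o d := by
  simp only [directionSign, SimpleGraph.Dart.symm, Prod.swap, o.pointsTo_symm_dart]
  cases o.pointsTo d.fst d.snd <;> rfl

open Classical in
variable {o} in
/-- The sign that marks the edges chosen for the isolated odd faces. -/
noncomputable def choiceSign (e : Sym2 (Vertex n)) : ℤˣ :=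
  if ∃ f, (χ.edge f).edge = e then -1 else 1

variable {o} in
theorem EdgeChoice.edge_eq_iff (h : o.pointsTo d.fst d.snd) (f : IsolatedOddFace o) :
    (χ.edge f).edge = d.edge ↔ χ.edge f = d := by
  refine ⟨fun hf => ?_, fun hf => hf ▸ rfl⟩
  refine ((SimpleGraph.dart_edge_eq_iff _ _).1 hf).resolve_right fun h_symm => ?_
  have hp := χ.pointsTo f
  rw [h_symm] at hp
  have := o.pointsTo_symm_dart d
  simp_all [SimpleGraph.Dart.symm]

theorem forwardOp_eq (h : o.pointsTo d.fst d.snd) :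
    forwardOp o χ d = choiceSign χ d.edge • word (edgeLabel o d) := by
  simp only [forwardOp, choiceSign, rawEdgeOp_eq o h, χ.edge_eq_iff h]
  split_ifs <;> simp [Units.neg_smul]

theorem edgeOp_eq (d : (graph n).Dart) :
    edgeOp o χ d = (directionSign o d * choiceSign χ d.edge) • word (edgeLabel o d) := by
  unfold edgeOp directionSign
  split_ifs with h
  · rw [one_mul, forwardOp_eq o χ h]
  · have h_symm : o.pointsTo d.symm.fst d.symm.snd := by
      simpa [SimpleGraph.Dart.symm, o.pointsTo_symm_dart] using h
    rw [forwardOp_eq o χ h_symm, SimpleGraph.Dart.edge_symm, edgeLabel_symm, neg_mul, one_mul,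
      Units.neg_smul]

theorem vertexOp_mul_self (v : Vertex n) : vertexOp o v * vertexOp o v = 1 := by
  rw [vertexOp_eq, word_mul_self]

theorem edgeOp_mul_self (d : (graph n).Dart) : edgeOp o χ d * edgeOp o χ d = 1 := by
  rw [edgeOp_eq, smul_mul_smul_comm, word_mul_self, Int.units_mul_self, one_smul]

theorem edgeOp_symm (d : (graph n).Dart) : edgeOp o χ d = -edgeOp o χ d.symm := by
  rw [edgeOp_eq, edgeOp_eq, edgeLabel_symm, directionSign_symm, SimpleGraph.Dart.edge_symm,
    neg_mul, Units.neg_smul, neg_neg]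

theorem edgeOp_mul_vertexOp (d : (graph n).Dart) (v : Vertex n) :
    edgeOp o χ d * vertexOp o v =
      (if v ∈ d.edge then -1 else 1 : ℤˣ) • (vertexOp o v * edgeOp o χ d) := by
  rw [edgeOp_eq, vertexOp_eq, smul_mul_assoc, mul_smul_comm, word_mul_word_single,
    commSign_edgeLabel_vertex, smul_comm]

theorem edgeOp_mul_edgeOp_of_disjoint (h : ∀ u ∈ d.edge, u ∉ d'.edge) :
    edgeOp o χ d * edgeOp o χ d' = edgeOp o χ d' * edgeOp o χ d := by
  rw [edgeOp_eq, edgeOp_eq, smul_mul_smul_comm, smul_mul_smul_comm,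
    word_edgeLabel_mul_of_disjoint h, mul_comm]

theorem edgeOp_mul_edgeOp_of_snd_eq_fst (hn : ∀ k, ∃ l, l ≠ k ∧ 0 < n l) (h : d.snd = d'.fst)
    (h' : d.fst ≠ d'.snd) : edgeOp o χ d * edgeOp o χ d' = -(edgeOp o χ d' * edgeOp o χ d) := by
  rw [edgeOp_eq, edgeOp_eq, smul_mul_smul_comm, smul_mul_smul_comm,
    word_edgeLabel_mul_of_snd_eq_fst hn h h', smul_neg, mul_comm]

/-- The operators prescribed for the generators of `M_G`, as units. -/
noncomputable def genUnit : MGen (graph n) → (Op o)ˣ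
  | .phase => ⟨Complex.I • 1, -Complex.I • 1, by simp [smul_smul], by simp [smul_smul]⟩
  | .vert v => ⟨vertexOp o v, vertexOp o v, vertexOp_mul_self o v, vertexOp_mul_self o v⟩
  | .edge d => ⟨edgeOp o χ d, edgeOp o χ d, edgeOp_mul_self o χ d, edgeOp_mul_self o χ d⟩

variable {χ} in
theorem lift_genUnit_eq_of_rel (hn : ∀ k, ∃ l, l ≠ k ∧ 0 < n l)
    {a b : FreeGroup (MGen (graph n))} (h : MRel (graph n) a b) :
    FreeGroup.lift (genUnit o χ) a = FreeGroup.lift (genUnit o χ) b := by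
  have hI : (genUnit o χ .phase : Op o) = Complex.I • 1 := rfl
  have hI2 : (genUnit o χ .phase : Op o) ^ 2 = -1 := by simp [hI, smul_pow]
  have hv (v) : (genUnit o χ (.vert v) : Op o) = vertexOp o v := rfl
  have he (d) : (genUnit o χ (.edge d) : Op o) = edgeOp o χ d := rfl
  refine Units.ext ?_
  cases h <;>
    simp only [MGen.I, MGen.v, MGen.e, map_mul, map_pow, FreeGroup.lift_apply_of, map_one,
      Units.val_mul, Units.val_pow_eq_pow_val, Units.val_one, hI2, hv, he, neg_mul, one_mul]
  case phase_order => rw [show 4 = 2 * 2 from rfl, pow_mul, hI2, neg_one_sq]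
  case phase_central => simp [hI]
  case edge_sq d => rw [pow_two, edgeOp_mul_self]
  case vert_sq v => rw [pow_two, vertexOp_mul_self]
  case edge_symm d => exact edgeOp_symm o χ d
  case vert_vert v w =>
    have h_comm : commSign (single (Q := Qubit o) (.inl v) 2 (.inl w)) (some 2) = 1 := by
      unfold single; split_ifs <;> rfl
    rw [vertexOp_eq, vertexOp_eq, word_mul_word_single, h_comm, one_smul]
  case edge_vert_comm d v h₁ h₂ =>
    rw [edgeOp_mul_vertexOp, if_neg (by simp [SimpleGraph.Dart.edge, h₁, h₂]), one_smul]
  case edge_edge_comm d d' h₁ h₂ h₃ h₄ =>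
    exact edgeOp_mul_edgeOp_of_disjoint o χ (by simp [SimpleGraph.Dart.edge, h₁, h₂, h₃, h₄])
  case edge_vert_anti d =>
    rw [edgeOp_mul_vertexOp, if_pos (show d.snd ∈ d.edge from Sym2.mem_mk_right _ _),
      Units.neg_smul, one_smul]
  case edge_edge_anti d d' h h' => exact edgeOp_mul_edgeOp_of_snd_eq_fst o χ hn h h'

theorem exists_isEncoding (hn : ∀ k, ∃ l, l ≠ k ∧ 0 < n l) :
    ∃ σ : MGroup (graph n) →* Op o, IsEncoding o χ σ := by
  refine ⟨(Units.coeHom (Op o)).comp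
    (MGroup.lift (genUnit o χ) fun _ _ => lift_genUnit_eq_of_rel o hn), ?_, fun v => ?_,
    fun d => ?_⟩ <;>
    simp only [MonoidHom.comp_apply, MGroup.I, MGroup.vert, MGroup.edge, MGroup.lift_of] <;> rfl

end Operators

end Cubic

/-! ### The cycles around faces and pairs of faces -/

namespace Cubic

variable {n : Fin 3 → ℕ}

namespace Face

/-- The coordinates of the four vertices of a face in the order of the walk around it, relative to
its corner. The coordinate directions are counted from the normal direction of the face. -/
def offset : Fin 4 → Fin 3 → Fin 2 := ![![0, 0, 0], ![0, 1, 0], ![0, 1, 1], ![0, 0, 1]]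

/-- The direction of the `i`-th step of the walk around a face, counted from the normal direction
of the face. -/
def turn : Fin 4 → Fin 3 := ![1, 2, 1, 2]

theorem offset_zero (i : Fin 4) : offset i 0 = 0 := by revert i; decide

theorem offset_add_one (i : Fin 4) :
    ((offset (i + 1) (turn i) : ℕ) = offset i (turn i) + 1 ∨
      (offset i (turn i) : ℕ) = offset (i + 1) (turn i) + 1) ∧
      ∀ k, k ≠ turn i → offset (i + 1) k = offset i k := by
  revert i; decide

theorem offset_injective : Function.Injective offset := by decide

theorem exists_offset_eq (s t : Fin 2) : ∃ i, offset i 1 = s ∧ offset i 2 = t := by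
  revert s t; decide

variable (f : Face n)

/-- The `i`-th vertex on the walk around `f`. -/
def pt (i : Fin 4) : Vertex n := fun j =>
  ⟨f.corner j + offset i (j - f.axis), by
    obtain rfl | hj := eq_or_ne j f.axis
    · rw [sub_self, offset_zero]
      exact (f.corner f.axis).isLt
    · have := f.lt j hj
      omega⟩

theorem pt_val (i : Fin 4) (j : Fin 3) :
    (f.pt i j : ℕ) = f.corner j + offset i (j - f.axis) := rfl

theorem pt_injective : Function.Injective f.pt := fun i i' h => offset_injective <| by
  funext k
  have hk := congrArg Fin.val (congrFun h (k + f.axis))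
  rw [pt_val, pt_val, add_sub_cancel_right, Nat.add_left_cancel_iff] at hk
  exact Fin.ext hk

theorem hasVertex_pt (i : Fin 4) : f.HasVertex (f.pt i) := by
  refine ⟨Fin.ext ?_, fun j _ => ?_⟩
  · rw [pt_val, sub_self, offset_zero]
    rfl
  · rw [pt_val]
    omega

theorem along_pt (i : Fin 4) : Along (f.axis + turn i) (f.pt i) (f.pt (i + 1)) := by
  obtain ⟨h_turn, h_other⟩ := offset_add_one i
  have h_eq (l : Fin 3) (hl : l ≠ f.axis + turn i) : f.pt (i + 1) l = f.pt i l :=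
    Fin.ext <| by rw [pt_val, pt_val, h_other _ fun h => hl (sub_eq_iff_eq_add'.1 h)]
  refine h_turn.imp (fun h => ⟨?_, h_eq⟩) fun h => ⟨?_, fun l hl => (h_eq l hl).symm⟩ <;>
  · rw [pt_val, pt_val, add_sub_cancel_left, h, Nat.add_assoc]

/-- The `i`-th directed edge of the walk around `f`. -/
def side (i : Fin 4) : (graph n).Dart := ⟨(f.pt i, f.pt (i + 1)), _, f.along_pt i⟩

theorem dartDir_side (i : Fin 4) : dartDir (f.side i) = f.axis + turn i :=
  (f.along_pt i).dir_eq

theorem hasEdge_side (i : Fin 4) : f.HasEdge (f.side i).edge :=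
  hasEdge_edge.2 ⟨f.hasVertex_pt i, f.hasVertex_pt (i + 1)⟩

theorem side_edge_injective : Function.Injective fun i => (f.side i).edge := fun i j h => by
  have h_eq := Sym2.eq_iff.1 (show s(f.pt i, f.pt (i + 1)) = s(f.pt j, f.pt (j + 1)) from h)
  simp only [f.pt_injective.eq_iff] at h_eq
  clear h
  revert i j; decide

variable {f} {d : (graph n).Dart}

theorem eq_pt {v : Vertex n} {i : Fin 4} (h₀ : v f.axis = f.corner f.axis)
    (h₁ : (v (f.axis + 1) : ℕ) = f.corner (f.axis + 1) + offset i 1)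
    (h₂ : (v (f.axis + 2) : ℕ) = f.corner (f.axis + 2) + offset i 2) : v = f.pt i := by
  refine vertex_ext fun j => ?_
  have h_cases : j = f.axis ∨ j = f.axis + 1 ∨ j = f.axis + 2 := by
    generalize f.axis = a
    revert j a; decide
  obtain rfl | rfl | rfl := h_cases
  · rw [pt_val, sub_self, offset_zero, h₀]
    rfl
  · rw [pt_val, add_sub_cancel_left, h₁]
  · rw [pt_val, add_sub_cancel_left, h₂]

theorem HasVertex.exists_eq_pt {v : Vertex n} (hv : f.HasVertex v) : ∃ i, v = f.pt i := by
  have h₁ := hv.2 (f.axis + 1) (by simp)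
  have h₂ := hv.2 (f.axis + 2) (by simp)
  obtain ⟨i, hi₁, hi₂⟩ := exists_offset_eq
    ⟨v (f.axis + 1) - f.corner (f.axis + 1), by omega⟩
    ⟨v (f.axis + 2) - f.corner (f.axis + 2), by omega⟩
  refine ⟨i, eq_pt hv.1 ?_ ?_⟩
  · simp only [hi₁]
    omega
  · simp only [hi₂]
    omega

theorem hasEdge_iff_exists_side : f.HasEdge d.edge ↔ ∃ i, (f.side i).edge = d.edge := by
  refine ⟨fun h => ?_, fun ⟨i, hi⟩ => hi ▸ f.hasEdge_side i⟩
  rw [hasEdge_edge] at h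
  obtain ⟨i, hi⟩ := h.1.exists_eq_pt
  obtain ⟨j, hj⟩ := h.2.exists_eq_pt
  have h_cases : j = i ∨ j = i + 1 ∨ i = j + 1 ∨
      (∀ k, k ≠ 0 → offset i k ≠ offset j k) := by
    clear * -; revert i j; decide
  obtain rfl | rfl | rfl | h_opp := h_cases
  · exact absurd (hi.trans hj.symm) d.adj.ne
  · exact ⟨i, (congrArg₂ (s(·, ·)) hi hj).symm⟩
  · exact ⟨j, Sym2.eq_swap.trans (congrArg₂ (s(·, ·)) hi hj).symm⟩
  · obtain ⟨k, hk, hkd⟩ : ∃ k : Fin 3, k ≠ 0 ∧ k + f.axis ≠ dartDir d := by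
      generalize dartDir d = l, f.axis = a
      revert l a; decide
    have h_eq := congrArg Fin.val ((along_dartDir d).eq_of_ne hkd)
    rw [hi, hj, pt_val, pt_val, add_sub_cancel_right, Nat.add_left_cancel_iff] at h_eq
    exact absurd (Fin.ext h_eq) (h_opp k hk)

theorem darts_walk (f : Face n) :
    f.walk.darts = [f.side 0, f.side 1, f.side 2, f.side 3] := by
  have h₁ := f.lt (f.axis + 1) (by simp)
  have h₂ := f.lt (f.axis + 2) (by simp)
  have h₃ : (up f.corner (f.axis + 1) h₁ (f.axis + 2) : ℕ) < n (f.axis + 2) := by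
    simpa [up] using h₂
  have h_pt₀ : f.corner = f.pt 0 := eq_pt rfl rfl rfl
  have h_pt₁ : up f.corner (f.axis + 1) h₁ = f.pt 1 :=
    eq_pt (by simp [up]) (by simp [up, offset]) (by simp [up, offset])
  have h_pt₂ : up (up f.corner (f.axis + 1) h₁) (f.axis + 2) h₃ = f.pt 2 :=
    eq_pt (by simp [up]) (by simp [up, offset]) (by simp [up, offset])
  have h_pt₃ : up f.corner (f.axis + 2) h₂ = f.pt 3 :=
    eq_pt (by simp [up]) (by simp [up, offset]) (by simp [up, offset])
  have cons_eq {d d' : (graph n).Dart} {l l' : List (graph n).Dart} (hfst : d.fst = d'.fst)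
      (hsnd : d.snd = d'.snd) (h : l = l') : d :: l = d' :: l' := by
    rw [SimpleGraph.Dart.ext _ _ (Prod.ext hfst hsnd), h]
  exact cons_eq h_pt₀ h_pt₁ (cons_eq h_pt₁ h_pt₂ (cons_eq h_pt₂ h_pt₃ (cons_eq h_pt₃ h_pt₀ rfl)))

theorem isTrail_walk (f : Face n) : f.walk.IsTrail := by
  have h_edges : f.walk.edges = List.ofFn fun i => (f.side i).edge := by
    rw [SimpleGraph.Walk.edges, darts_walk]
    rfl
  exact ⟨h_edges ▸ List.nodup_ofFn.2 f.side_edge_injective⟩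

end Face

open MGroup

theorem faceCycle_eq (f : Face n) :
    faceCycle f =
      edge _ (f.side 0) * edge _ (f.side 1) * edge _ (f.side 2) * edge _ (f.side 3) := by
  have h_length : f.walk.length = 4 := by
    rw [← SimpleGraph.Walk.length_darts, Face.darts_walk]
    rfl
  rw [faceCycle, ofWalk, h_length, I_pow_four, Face.darts_walk]
  simp only [List.map_cons, List.map_nil, List.prod_cons, List.prod_nil, one_mul, mul_one,
    mul_assoc]

theorem faceCycle_mem_cycles (f : Face n) : faceCycle f ∈ cycles (graph n) :=
  Subgroup.subset_closure ⟨_, _, rfl⟩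

theorem pairCycle_mem_cycles (c : Cell n) (k : Fin 3) : pairCycle c k ∈ cycles (graph n) :=
  mul_mem (faceCycle_mem_cycles _) (faceCycle_mem_cycles _)

variable {d : (graph n).Dart}

theorem edge_mem_oddEdges_faceCycle {f : Face n} :
    d.edge ∈ oddEdges (faceCycle f) ↔ f.HasEdge d.edge := by
  rw [faceCycle, oddEdges_ofWalk_of_isTrail f.isTrail_walk, Set.mem_ofPred_eq,
    SimpleGraph.Walk.edges, Face.darts_walk, Face.hasEdge_iff_exists_side]
  simp [Fin.exists_fin_succ, eq_comm]

theorem edge_mem_oddEdges_pairCycle {c : Cell n} {k : Fin 3} :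
    d.edge ∈ oddEdges (pairCycle c k) ↔ c.HasEdge d.edge ∧ dartDir d ≠ k := by
  rw [pairCycle, oddEdges_mul, Set.mem_symmDiff, edge_mem_oddEdges_faceCycle,
    edge_mem_oddEdges_faceCycle, Face.IsFaceOf.hasEdge_iff ⟨k, .inl rfl⟩,
    Face.IsFaceOf.hasEdge_iff ⟨k, .inr rfl⟩]
  have h_lower : base d (c.lower k).axis = (c.lower k).corner (c.lower k).axis ↔
      (base d k : ℕ) = c k := Fin.ext_iff
  have h_upper : base d (c.upper k).axis = (c.upper k).corner (c.upper k).axis ↔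
      (base d k : ℕ) = c k + 1 := by
    simp [Cell.upper, Fin.ext_iff]
  rw [h_lower, h_upper]
  constructor
  · rintro (h | h) <;> exact ⟨h.1.1, h.1.2.1⟩
  · rintro ⟨hc, hd⟩
    refine ((Cell.hasEdge_edge_iff.1 hc).2 k hd.symm).imp (fun h => ?_) fun h => ?_ <;>
    exact ⟨⟨hc, hd, h⟩, fun h' => by omega⟩
end Cubic

/-! ### The operators of the cycles around odd faces -/

namespace Pauli

/-- The product of four Pauli matrices or identities, in the given order. -/
def optProd (x : Fin 4 → Option (Fin 3)) : Matrix (Fin 2) (Fin 2) ℂ :=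
  opt (x 0) * opt (x 1) * opt (x 2) * opt (x 3)

theorem optProd_eq_opt {x : Fin 4 → Option (Fin 3)} (i : Fin 4) (h : ∀ j, j ≠ i → x j = none) :
    optProd x = opt (x i) := by
  have h_one (j : Fin 4) (hj : j ≠ i) : opt (x j) = 1 := by
    rw [h j hj]
    rfl
  fin_cases i <;> simp [optProd, h_one]

theorem optProd_eq_one {x : Fin 4 → Option (Fin 3)} (i : Fin 4) (h_eq : x i = x (i + 1))
    (h : ∀ j, j ≠ i → j ≠ i + 1 → x j = none) : optProd x = 1 := by
  have h_sq : opt (x i) * opt (x (i + 1)) = 1 := h_eq ▸ opt_mul_opt_self (x i)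
  have h_sq' : opt (x (i + 1)) * opt (x i) = 1 := h_eq ▸ opt_mul_opt_self (x i)
  have h_one (j : Fin 4) (hj : j ≠ i) (hj' : j ≠ i + 1) : opt (x j) = 1 := by
    rw [h j hj hj']
    rfl
  clear h h_eq
  fin_cases i <;> simp_all [optProd]

theorem optProd_of_ne {k l : Fin 3} (h : k ≠ l) :
    optProd ![some k, some l, some k, some l] = -1 := by
  change mat k * mat l * mat k * mat l = -1
  rw [mat_mul_mat_of_ne h, neg_mul, mul_assoc (mat l), mat_mul_mat_self, mul_one, neg_mul,
    mat_mul_mat_self]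

end Pauli

namespace Cubic

open Pauli MGroup

variable {n : Fin 3 → ℕ} {o : Orientation n} {f g : Face n}

theorem Face.side_inj_of_hasEdge (hfg : f ≠ g) {i j : Fin 4} (hi : g.HasEdge (f.side i).edge)
    (hj : g.HasEdge (f.side j).edge) : i = j := by
  have h_next (i : Fin 4) (hi : g.HasEdge (f.side i).edge) :
      ¬ g.HasEdge (f.side (i + 1)).edge := fun hi' => by
    refine hfg (eq_of_hasEdge ?_ (f.hasEdge_side i) (f.hasEdge_side (i + 1)) hi hi')
    rw [dartDir_side, dartDir_side, Ne, add_right_inj]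
    clear * -; revert i; decide
  have h_cases : i = j ∨ j = i + 1 ∨ i = j + 1 ∨ j = i + 1 + 1 := by
    clear * -; revert i j; decide
  obtain h | rfl | rfl | rfl := h_cases
  · exact h
  · exact absurd hj (h_next i hi)
  · exact absurd hi (h_next j hj)
  · rw [hasEdge_edge] at hi hj
    exact absurd (hasEdge_edge.2 ⟨hi.2, hj.1⟩) (h_next i (hasEdge_edge.2 hi))

section OddFace

variable (hf : IsOddFace o.pointsTo f)
include hf

theorem pointsTo_side_add_one (i : Fin 4) :
    o.pointsTo (f.side (i + 1)).fst (f.side (i + 1)).snd =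
      o.pointsTo (f.side i).symm.fst (f.side i).symm.snd := by
  refine Orientation.pointsTo_eq_of_isOddFace hf rfl ?_ (f.hasEdge_side _)
    ((f.side i).edge_symm ▸ f.hasEdge_side i)
  rw [dartDir_symm, Face.dartDir_side, Face.dartDir_side, Ne, add_right_inj]
  revert i; decide

theorem directionSign_side_add_one (i : Fin 4) :
    directionSign o (f.side (i + 1)) = -directionSign o (f.side i) := by
  rw [← directionSign_symm, directionSign, directionSign, pointsTo_side_add_one hf]

theorem edgeLabel_side_add_one (i : Fin 4) :
    edgeLabel o (f.side i) (.inl (f.pt (i + 1))) =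
      edgeLabel o (f.side (i + 1)) (.inl (f.pt (i + 1))) := by
  rw [← edgeLabel_symm]
  exact edgeLabel_fst.trans (pointsTo_side_add_one hf i ▸ edgeLabel_fst.symm)

theorem optProd_edgeLabel_side_inl (u : Vertex n) :
    optProd (fun i => edgeLabel o (f.side i) (.inl u)) = 1 := by
  have h_none {i : Fin 4} (h : u ≠ f.pt i) (h' : u ≠ f.pt (i + 1)) :
      edgeLabel o (f.side i) (.inl u) = none :=
    edgeLabel_inl_of_notMem fun hu => (Sym2.mem_iff.1 hu).elim h h'
  by_cases hu : ∃ i, u = f.pt (i + 1)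
  · obtain ⟨i, rfl⟩ := hu
    refine optProd_eq_one i (edgeLabel_side_add_one hf i) fun j hj hj' => h_none ?_ ?_
    · exact fun h => hj' (f.pt_injective h).symm
    · exact fun h => hj (add_right_cancel (f.pt_injective h)).symm
  · rw [not_exists] at hu
    have h_ne (i : Fin 4) : u ≠ f.pt i := sub_add_cancel i 1 ▸ hu (i - 1)
    exact (optProd_eq_opt 0 fun j _ => h_none (h_ne j) (h_ne _)).trans
      (congrArg opt (h_none (h_ne _) (h_ne _)))

variable (o f) in
omit hf in
/-- Up to sign, the operator of the cycle around an odd face `f` acts on the qubit of every odd face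
that meets `f` along an edge with the Pauli matrix of the direction of this edge, and trivially on
the other qubits. This direction is orthogonal to both normal directions, and equal to minus their
sum in `Fin 3`. -/
def faceLabel : Qubit o → Option (Fin 3)
  | .inl _ => none
  | .inr g =>
    if f.axis ≠ g.1.axis ∧ ∃ i, g.1.HasEdge (f.side i).edge then some (-(f.axis + g.1.axis))
    else none

theorem optProd_edgeLabel_side_inr_self :
    optProd (fun i => edgeLabel o (f.side i) (.inr ⟨f, hf⟩)) = -1 := by
  have h_ne : f.axis + 1 ≠ f.axis + 2 := by simp
  refine Eq.trans (congrArg optProd (funext fun i => ?_)) (optProd_of_ne h_ne)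
  rw [edgeLabel_inr, if_pos (f.hasEdge_side i), Face.dartDir_side]
  fin_cases i <;> rfl

theorem optProd_edgeLabel_side_inr {a : Fin 3 → ℕ} (ha : IsParity o a) {g : OddFace o}
    (hfg : f ≠ g.1) :
    optProd (fun i => edgeLabel o (f.side i) (.inr g)) = opt (faceLabel o f (.inr g)) := by
  simp only [edgeLabel_inr]
  by_cases hg : ∃ i, g.1.HasEdge (f.side i).edge
  · obtain ⟨i, hi⟩ := hg
    have h_axis : f.axis ≠ g.1.axis := fun h =>
      hfg (ha.eq_of_axis_eq hf g.2 h (f.hasEdge_side i) hi)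
    have h_dir : dartDir (f.side i) = -(f.axis + g.1.axis) := by
      have h₁ := (f.hasEdge_side i).dartDir_ne_axis
      have h₂ := hi.dartDir_ne_axis
      generalize dartDir (f.side i) = k, f.axis = b, g.1.axis = c at *
      clear * - h_axis h₁ h₂
      revert b c k; decide
    rw [optProd_eq_opt i fun j hj => if_neg fun h => hj (Face.side_inj_of_hasEdge hfg h hi),
      if_pos hi, faceLabel, if_pos ⟨h_axis, i, hi⟩, h_dir]
  · rw [faceLabel, if_neg fun h => hg h.2]
    rw [not_exists] at hg
    exact (optProd_eq_opt 0 fun j _ => if_neg (hg j)).trans (congrArg opt (if_neg (hg 0)))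

end OddFace

variable {a : Fin 3 → ℕ} {χ : EdgeChoice o} {σ : MGroup (graph n) →* Op o}

theorem tensor_optProd_edgeLabel_side (ha : IsParity o a) (hf : IsOddFace o.pointsTo f) :
    tensor (fun q => optProd fun i => edgeLabel o (f.side i) q) = -word (faceLabel o f) := by
  have h_sign : ∏ q : Qubit o, (if q = .inr ⟨f, hf⟩ then -1 else 1 : ℤˣ) = -1 :=
    (Fintype.prod_eq_single (.inr ⟨f, hf⟩ : Qubit o) fun _ hq => if_neg hq).trans (if_pos rfl)
  rw [word, ← one_smul ℤˣ (tensor fun q => opt _), ← Units.neg_smul, ← h_sign,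
    ← tensor_units_smul]
  refine congrArg tensor (funext fun q => ?_)
  split_ifs with hq
  · rw [hq, optProd_edgeLabel_side_inr_self, faceLabel, if_neg fun h => h.1 rfl, Units.neg_smul,
      one_smul]
    rfl
  · rw [one_smul]
    obtain u | g := q
    · exact optProd_edgeLabel_side_inl hf u
    · exact optProd_edgeLabel_side_inr hf ha fun h => hq (congrArg _ (Subtype.ext h.symm))

theorem map_faceCycle (hσ : IsEncoding o χ σ) (ha : IsParity o a) (hf : IsOddFace o.pointsTo f) :
    σ (faceCycle f) = -((∏ i, choiceSign χ (f.side i).edge) • word (faceLabel o f)) := by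
  have h₁ : directionSign o (f.side 1) = -directionSign o (f.side 0) :=
    directionSign_side_add_one hf 0
  have h₂ : directionSign o (f.side 2) = -directionSign o (f.side 1) :=
    directionSign_side_add_one hf 1
  have h₃ : directionSign o (f.side 3) = -directionSign o (f.side 2) :=
    directionSign_side_add_one hf 2
  rw [← smul_neg, ← tensor_optProd_edgeLabel_side ha hf, faceCycle_eq]
  simp only [map_mul, hσ.edge, edgeOp_eq, smul_mul_smul_comm]
  refine congrArg₂ (· • ·) ?_ ?_
  · rw [h₃, h₂, h₁, Fin.prod_univ_four]
    obtain h | h := Int.units_eq_one_or (directionSign o (f.side 0)) <;> simp [h]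
  · simp only [word, tensor_mul, optProd]

theorem faceLabel_of_isIsolatedOddFace (ha : IsParity o a) (hf : IsIsolatedOddFace o f) :
    faceLabel o f = fun _ => none := by
  funext q
  obtain u | g := q
  · rfl
  · refine if_neg fun ⟨h_axis, i, hi⟩ => h_axis ?_
    rw [ha.eq_of_isIsolatedOddFace hf g.2 (f.hasEdge_side i) hi]

theorem EdgeChoice.hasEdge (χ : EdgeChoice o) (f : IsolatedOddFace o) :
    f.1.HasEdge (χ.edge f).edge :=
  Face.hasEdge_edge.2 (χ.mem f)

theorem eq_of_edgeChoice_eq_side (ha : IsParity o a) (hf : IsOddFace o.pointsTo f)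
    {f' : IsolatedOddFace o} {i : Fin 4} (h : (χ.edge f').edge = (f.side i).edge) : f'.1 = f :=
  ha.eq_of_isIsolatedOddFace f'.2 hf (χ.hasEdge f') (h ▸ f.hasEdge_side i)

theorem prod_choiceSign_of_isIsolatedOddFace (ha : IsParity o a) (hf : IsIsolatedOddFace o f) :
    ∏ i, choiceSign χ (f.side i).edge = -1 := by
  obtain ⟨i, hi⟩ := Face.hasEdge_iff_exists_side.1 (χ.hasEdge ⟨f, hf⟩)
  rw [Fintype.prod_eq_single i, choiceSign, if_pos ⟨_, hi.symm⟩]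
  refine fun j hj => if_neg fun ⟨f', hf'⟩ => hj (f.side_edge_injective ?_)
  obtain rfl : f' = ⟨f, hf⟩ := Subtype.ext (eq_of_edgeChoice_eq_side ha hf.1 hf')
  exact (hi.trans hf').symm

theorem map_faceCycle_of_isIsolatedOddFace (hσ : IsEncoding o χ σ) (ha : IsParity o a)
    (hf : IsIsolatedOddFace o f) : σ (faceCycle f) = 1 := by
  rw [map_faceCycle hσ ha hf.1, prod_choiceSign_of_isIsolatedOddFace ha hf,
    faceLabel_of_isIsolatedOddFace ha hf, Units.neg_smul, one_smul, neg_neg]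
  exact tensor_one

variable {c : Cell n}

theorem choiceSign_side_of_isFaceOf (ha : IsParity o a) (hc : IsOddCell o c) (hf : f.IsFaceOf c)
    (i : Fin 4) : choiceSign χ (f.side i).edge = 1 :=
  if_neg fun ⟨f', hf'⟩ =>
    f'.2.2.2 c hc (eq_of_edgeChoice_eq_side ha (hc f hf) hf' ▸ hf)

theorem map_faceCycle_of_isFaceOf (hσ : IsEncoding o χ σ) (ha : IsParity o a)
    (hc : IsOddCell o c) (hf : f.IsFaceOf c) : σ (faceCycle f) = -word (faceLabel o f) := by
  simp only [map_faceCycle hσ ha (hc f hf), choiceSign_side_of_isFaceOf ha hc hf,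
    Finset.prod_const_one, one_smul]

theorem faceLabel_inr_of_isFaceOf (ha : IsParity o a) (hc : IsOddCell o c) (hf : f.IsFaceOf c)
    (g : OddFace o) : faceLabel o f (.inr g) =
      if f.axis ≠ g.1.axis ∧ g.1.IsFaceOf c then some (-(f.axis + g.1.axis)) else none := by
  rw [faceLabel]
  refine if_congr (and_congr_right fun h_axis => ?_) rfl rfl
  rw [ha.isFaceOf_iff_exists_hasEdge hc hf g.2 h_axis]
  exact ⟨fun ⟨i, hi⟩ => ⟨f.side i, f.hasEdge_side i, hi⟩, fun ⟨d, hfd, hgd⟩ =>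
    (Face.hasEdge_iff_exists_side.1 hfd).imp fun _ hi => by rwa [hi]⟩

theorem map_pairCycle (hσ : IsEncoding o χ σ) (ha : IsParity o a) (hc : IsOddCell o c)
    (k : Fin 3) : σ (pairCycle c k) = 1 := by
  have h_lower : (c.lower k).IsFaceOf c := ⟨k, .inl rfl⟩
  have h_upper : (c.upper k).IsFaceOf c := ⟨k, .inr rfl⟩
  have h_label : faceLabel o (c.lower k) = faceLabel o (c.upper k) := funext fun q =>
    match q with
    | .inl _ => rfl
    | .inr g => (faceLabel_inr_of_isFaceOf ha hc h_lower g).trans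
        (faceLabel_inr_of_isFaceOf ha hc h_upper g).symm
  rw [pairCycle, map_mul, map_faceCycle_of_isFaceOf hσ ha hc h_lower,
    map_faceCycle_of_isFaceOf hσ ha hc h_upper, h_label, neg_mul_neg, word_mul_self]

end Cubic

/-! ### The kernel -/

namespace Cubic

open Pauli MGroup

variable {n : Fin 3 → ℕ}

theorem exists_dart_edge_eq {e : Sym2 (Vertex n)} (he : e ∈ (graph n).edgeSet) :
    ∃ d : (graph n).Dart, d.edge = e := by
  induction e with | h v w => exact ⟨⟨(v, w), he⟩, rfl⟩

theorem Face.edge_eq_of_ne_of_ne {f : Face n} {d d' e : (graph n).Dart} (hfd : f.HasEdge d.edge)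
    (hfd' : f.HasEdge d'.edge) (hfe : f.HasEdge e.edge) (hdir' : dartDir d' = dartDir d)
    (hdir : dartDir e = dartDir d) (hne' : d'.edge ≠ d.edge) (hne : e.edge ≠ d.edge) :
    e.edge = d'.edge := by
  rw [hasEdge_edge_iff] at hfd hfd' hfe
  obtain ⟨l, hld, hl_axis, h_cases⟩ := exists_third hfd.1
  have h_ext {d₁ d₂ : (graph n).Dart} (h₁ : dartDir d₁ = dartDir d) (h₂ : dartDir d₂ = dartDir d)
      (h_face₁ : f.HasVertex (base d₁) ∧ base d₁ (dartDir d₁) = f.corner (dartDir d₁))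
      (h_face₂ : f.HasVertex (base d₂) ∧ base d₂ (dartDir d₂) = f.corner (dartDir d₂))
      (h : (base d₁ l : ℕ) = base d₂ l) : d₁.edge = d₂.edge := by
    refine edge_eq_of_base_eq (h₁.trans h₂.symm) fun j => ?_
    obtain rfl | rfl | rfl := h_cases j
    · rw [← h₁, h_face₁.2, h₁, ← h₂, h_face₂.2]
    · rw [h_face₁.1.1, h_face₂.1.1]
    · exact h
  have := mt (h_ext hdir' rfl hfd'.2 hfd.2) hne'
  have := mt (h_ext hdir rfl hfe.2 hfd.2) hne
  have := hfd.2.1.2 l hl_axis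
  have := hfd'.2.1.2 l hl_axis
  have := hfe.2.1.2 l hl_axis
  exact h_ext hdir hdir' hfe.2 hfd'.2 (by omega)

variable {o : Orientation n} {χ : EdgeChoice o} {σ : MGroup (graph n) →* Op o}
  {m : MGroup (graph n)} {a : Fin 3 → ℕ} {d d' : (graph n).Dart}

namespace IsEncoding

theorem orderOf_map_I (hσ : IsEncoding o χ σ) : orderOf (σ (I (graph n))) = 4 := by
  rw [hσ.phase, ← Algebra.algebraMap_eq_smul_one]
  exact (orderOf_injective (algebraMap ℂ (Op o)).toMonoidHom
    (FaithfulSMul.algebraMap_injective ℂ (Op o)) Complex.I).trans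
      Complex.isPrimitiveRoot_I.eq_orderOf.symm

theorem exists_commSign_eq_neg_one (hσ : IsEncoding o χ σ) (hm : m ∈ cycleKernel (graph n) σ)
    (hd : d.edge ∈ oddEdges m) {q : Qubit o} {k : Fin 3}
    (h : commSign (edgeLabel o d q) (some k) = -1) :
    ∃ e : (graph n).Dart, e.edge ∈ oddEdges m ∧ e.edge ≠ d.edge ∧
      commSign (edgeLabel o e q) (some k) = -1 := by
  classical
  let s : Vertex n ⊕ Sym2 (Vertex n) → ℤˣ
    | .inl v => commSign (single (.inl v) 2 q) (some k)
    | .inr e => if h : ∃ d : (graph n).Dart, d.edge = e then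
        commSign (edgeLabel o h.choose q) (some k) else 1
  have hs (d : (graph n).Dart) : s (.inr d.edge) = commSign (edgeLabel o d q) (some k) := by
    have h : ∃ d' : (graph n).Dart, d'.edge = d.edge := ⟨d, rfl⟩
    exact (dif_pos h).trans (by rw [edgeLabel_congr h.choose_spec])
  obtain ⟨e, he, hed, hse⟩ := exists_mem_oddEdges_ne (s := s) (word_ne_neg_word (single q k))
    (hσ.phase ▸ (Commute.one_left _).smul_left _)
    (fun v => by rw [hσ.vert, vertexOp_eq]; exact word_mul_word_single _ q k)
    (fun d => by
      rw [hσ.edge, edgeOp_eq, hs, smul_mul_assoc, mul_smul_comm, word_mul_word_single, smul_comm])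
    hm hd ((hs d).trans h)
  obtain ⟨e, rfl⟩ := exists_dart_edge_eq (oddEdges_subset_edgeSet m he)
  exact ⟨e, he, hed, (hs e).symm.trans hse⟩

theorem mem_oddEdges_of_isOddFace (hσ : IsEncoding o χ σ) (hm : m ∈ cycleKernel (graph n) σ)
    {f : Face n} (hf : IsOddFace o.pointsTo f) (hfd : f.HasEdge d.edge) (hfd' : f.HasEdge d'.edge)
    (hdir : dartDir d' = dartDir d) (hd : d.edge ∈ oddEdges m) : d'.edge ∈ oddEdges m := by
  obtain ⟨l, hld, hl_axis, -⟩ := exists_third hfd.dartDir_ne_axis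
  obtain ⟨e, he, hed, h_sign⟩ := hσ.exists_commSign_eq_neg_one hm hd (q := .inr ⟨f, hf⟩) (k := l)
    (by rw [edgeLabel_inr, if_pos hfd, commSign_some_some, if_neg hld.symm])
  have hfe : f.HasEdge e.edge := by
    by_contra hfe
    rw [edgeLabel_inr, if_neg hfe, commSign_none_left] at h_sign
    exact absurd h_sign (by decide)
  have hle : l ≠ dartDir e := by
    rintro rfl
    rw [edgeLabel_inr, if_pos hfe, commSign_some_some, if_pos rfl] at h_sign
    exact absurd h_sign (by decide)
  have hdir_e : dartDir e = dartDir d := eq_of_ne_of_ne hl_axis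
    ⟨hle.symm, hfe.dartDir_ne_axis⟩ ⟨hld.symm, hfd.dartDir_ne_axis⟩
  by_cases hne : d'.edge = d.edge
  · rwa [hne]
  · rwa [← Face.edge_eq_of_ne_of_ne hfd hfd' hfe hdir hdir_e hne hed]

theorem mem_oddEdges_of_isOddCell_of_base_eq (hσ : IsEncoding o χ σ)
    (hm : m ∈ cycleKernel (graph n) σ) {c : Cell n} (hc : IsOddCell o c) (hcd : c.HasEdge d.edge)
    (hcd' : c.HasEdge d'.edge) (hdir : dartDir d' = dartDir d) {l : Fin 3} (hl : l ≠ dartDir d)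
    (h_base : base d' l = base d l) (hd : d.edge ∈ oddEdges m) : d'.edge ∈ oddEdges m := by
  obtain ⟨f, hfc, rfl, hfd⟩ := hcd.exists_isFaceOf hl
  have h_corner := (hfc.hasEdge_iff.1 hfd).2.2
  exact hσ.mem_oddEdges_of_isOddFace hm (hc f hfc) hfd
    (hfc.hasEdge_iff.2 ⟨hcd', hdir ▸ hl.symm, h_base.trans h_corner⟩) hdir hd

theorem mem_oddEdges_of_isOddCell (hσ : IsEncoding o χ σ) (hm : m ∈ cycleKernel (graph n) σ)
    {c : Cell n} (hc : IsOddCell o c) (hcd : c.HasEdge d.edge) (hcd' : c.HasEdge d'.edge)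
    (hdir : dartDir d' = dartDir d) (hd : d.edge ∈ oddEdges m) : d'.edge ∈ oddEdges m := by
  obtain ⟨i, hi⟩ := exists_ne (dartDir d)
  obtain ⟨l, hld, hli, h_cases⟩ := exists_third hi.symm
  let v : Vertex n := Function.update (base d') i (base d i)
  have hv_i : v i = base d i := Function.update_self ..
  have hv_ne (j : Fin 3) (hj : j ≠ i) : v j = base d' j := Function.update_of_ne hj ..
  let e := upDart v (dartDir d') (hv_ne _ (hdir ▸ hi.symm) ▸ base_lt d')
  have hdir_e : dartDir e = dartDir d' := dartDir_upDart ..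
  have h_base : base e = v := base_upDart ..
  have hce : c.HasEdge e.edge := by
    rw [Cell.hasEdge_edge_iff] at hcd hcd' ⊢
    rw [hdir_e, h_base, hv_ne _ (hdir ▸ hi.symm)]
    refine ⟨hcd'.1, fun j hj => ?_⟩
    obtain rfl | hji := eq_or_ne j i
    · exact hv_i ▸ hcd.2 j hi
    · exact hv_ne j hji ▸ hcd'.2 j hj
  have he : e.edge ∈ oddEdges m := hσ.mem_oddEdges_of_isOddCell_of_base_eq hm hc hcd hce
    (hdir_e.trans hdir) hi (h_base ▸ hv_i) hd
  exact hσ.mem_oddEdges_of_isOddCell_of_base_eq hm hc hce hcd' hdir_e.symm (l := l)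
    (hdir_e ▸ hdir ▸ hld) (h_base ▸ (hv_ne l hli).symm) he

theorem exists_isOddFace (hn : ∀ k, ∃ l, l ≠ k ∧ 0 < n l) (hσ : IsEncoding o χ σ)
    (hm : m ∈ cycleKernel (graph n) σ) (hd : d.edge ∈ oddEdges m) :
    ∃ (f : Face n) (e : (graph n).Dart), IsOddFace o.pointsTo f ∧ f.HasEdge d.edge ∧
      f.HasEdge e.edge ∧ dartDir d ≠ dartDir e ∧ e.edge ∈ oddEdges m := by
  obtain ⟨e, he, hed, h_sign⟩ := hσ.exists_commSign_eq_neg_one hm hd (q := .inl d.fst)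
    (k := if o.pointsTo d.fst d.snd then 1 else 0)
    (by rw [edgeLabel_fst]; cases o.pointsTo d.fst d.snd <;> rfl)
  have h_mem : d.fst ∈ e.edge := by
    by_contra h_mem
    rw [edgeLabel_inl_of_notMem h_mem, commSign_none_left] at h_sign
    exact absurd h_sign (by decide)
  obtain ⟨e', he', hfst⟩ : ∃ e' : (graph n).Dart, e'.edge = e.edge ∧ d.fst = e'.fst :=
    (Sym2.mem_iff.1 h_mem).elim (fun h => ⟨e, rfl, h⟩) fun h => ⟨e.symm, e.edge_symm, h⟩
  rw [← he'] at he hed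
  rw [← edgeLabel_congr he', hfst, edgeLabel_fst, ← hfst] at h_sign
  have h_points : o.pointsTo d.fst d.snd = o.pointsTo e'.fst e'.snd := by
    rw [← hfst]
    generalize o.pointsTo d.fst d.snd = x, o.pointsTo d.fst e'.snd = y at h_sign
    clear * - h_sign
    revert x y; decide
  have h_ne : d.snd ≠ e'.snd := fun h =>
    hed (congrArg SimpleGraph.Dart.edge (SimpleGraph.Dart.ext _ _ (Prod.ext hfst h))).symm
  have hdir : dartDir d ≠ dartDir e' := fun h => by
    obtain ⟨l, hl, hl'⟩ := hn (dartDir d)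
    have h_collinear := o.pointsTo_collinear hl hl' (along_dartDir d)
      (hfst ▸ h ▸ along_dartDir e') h_ne
    rw [h_points, ← hfst] at h_collinear
    exact Bool.not_ne_self _ h_collinear.symm
  obtain ⟨f, hfd, hfe⟩ := Face.exists_hasEdge hdir (u := d.fst) (Sym2.mem_mk_left _ _)
    (hfst ▸ Sym2.mem_mk_left _ _)
  exact ⟨f, e', (o.isOddFace_iff_pointsTo_eq hfst hdir hfd hfe).2 h_points, hfd, hfe, hdir, he⟩

end IsEncoding

/-- The cycles that generate the kernel: those around isolated odd faces and those around pairs of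
opposite faces of odd cells. -/
def basicCycles (o : Orientation n) : Set (MGroup (graph n)) :=
  {g | ∃ f, IsIsolatedOddFace o f ∧ faceCycle f = g} ∪
    {g | ∃ c k, IsOddCell o c ∧ pairCycle c k = g}

namespace IsEncoding

theorem faceCycle_mem_cycleKernel (hσ : IsEncoding o χ σ) (ha : IsParity o a) {f : Face n}
    (hf : IsIsolatedOddFace o f) : faceCycle f ∈ cycleKernel (graph n) σ :=
  ⟨faceCycle_mem_cycles f, map_faceCycle_of_isIsolatedOddFace hσ ha hf⟩

theorem pairCycle_mem_cycleKernel (hσ : IsEncoding o χ σ) (ha : IsParity o a) {c : Cell n}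
    (hc : IsOddCell o c) (k : Fin 3) : pairCycle c k ∈ cycleKernel (graph n) σ :=
  ⟨pairCycle_mem_cycles c k, map_pairCycle hσ ha hc k⟩

theorem basicCycles_subset_cycleKernel (hσ : IsEncoding o χ σ) (ha : IsParity o a) :
    basicCycles o ⊆ cycleKernel (graph n) σ := by
  rintro _ (⟨f, hf, rfl⟩ | ⟨c, k, hc, rfl⟩)
  exacts [hσ.faceCycle_mem_cycleKernel ha hf, hσ.pairCycle_mem_cycleKernel ha hc k]

theorem exists_basicCycle (hn : ∀ k, ∃ l, l ≠ k ∧ 0 < n l) (hσ : IsEncoding o χ σ)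
    (ha : IsParity o a) (hm : m ∈ cycleKernel (graph n) σ) (hd : d.edge ∈ oddEdges m) :
    ∃ g ∈ basicCycles o, d.edge ∈ oddEdges g ∧ oddEdges g ⊆ oddEdges m := by
  obtain ⟨f, e, hf, hfd, hfe, hdir, he⟩ := hσ.exists_isOddFace hn hm hd
  have h_dir {d' : (graph n).Dart} (h : dartDir d' ≠ f.axis) :
      dartDir d' = dartDir d ∨ dartDir d' = dartDir e :=
    or_iff_not_imp_left.2 fun h' =>
      eq_of_ne_of_ne hfd.dartDir_ne_axis ⟨h', h⟩ ⟨hdir.symm, hfe.dartDir_ne_axis⟩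
  obtain hf_isolated | ⟨c, hc, hfc⟩ := ha.isIsolatedOddFace_or_exists_isOddCell hf
  · refine ⟨faceCycle f, .inl ⟨f, hf_isolated, rfl⟩, edge_mem_oddEdges_faceCycle.2 hfd,
      fun e' he' => ?_⟩
    obtain ⟨d', rfl⟩ := exists_dart_edge_eq (oddEdges_subset_edgeSet _ he')
    have hfd' : f.HasEdge d'.edge := edge_mem_oddEdges_faceCycle.1 he'
    obtain h | h := h_dir hfd'.dartDir_ne_axis
    · exact hσ.mem_oddEdges_of_isOddFace hm hf hfd hfd' h hd
    · exact hσ.mem_oddEdges_of_isOddFace hm hf hfe hfd' h he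
  · have hcd := hfc.hasEdge_iff.1 hfd
    have hce := hfc.hasEdge_iff.1 hfe
    refine ⟨pairCycle c f.axis, .inr ⟨c, f.axis, hc, rfl⟩,
      edge_mem_oddEdges_pairCycle.2 ⟨hcd.1, hcd.2.1⟩, fun e' he' => ?_⟩
    obtain ⟨d', rfl⟩ := exists_dart_edge_eq (oddEdges_subset_edgeSet _ he')
    obtain ⟨hcd', hd'_axis⟩ := edge_mem_oddEdges_pairCycle.1 he'
    obtain h | h := h_dir hd'_axis
    · exact hσ.mem_oddEdges_of_isOddCell hm hc hcd.1 hcd' h hd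
    · exact hσ.mem_oddEdges_of_isOddCell hm hc hce.1 hcd' h he

theorem closure_basicCycles (hn : ∀ k, ∃ l, l ≠ k ∧ 0 < n l) (hσ : IsEncoding o χ σ)
    (ha : IsParity o a) : Subgroup.closure (basicCycles o) = cycleKernel (graph n) σ := by
  have h_subset := hσ.basicCycles_subset_cycleKernel ha
  refine le_antisymm ((Subgroup.closure_le _).2 h_subset) fun m hm => ?_
  induction hN : (oddEdges m).ncard using Nat.strong_induction_on generalizing m with | _ N ih =>
  obtain h_empty | ⟨e, he⟩ := (oddEdges m).eq_empty_or_nonempty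
  · rw [eq_one_of_oddEdges_eq_empty hσ.orderOf_map_I hm h_empty]
    exact one_mem _
  · obtain ⟨d, rfl⟩ := exists_dart_edge_eq (oddEdges_subset_edgeSet m he)
    obtain ⟨g, hg, hdg, hgm⟩ := hσ.exists_basicCycle hn ha hm he
    have h_diff : oddEdges (m * g) = oddEdges m \ oddEdges g :=
      (oddEdges_mul m g).trans (symmDiff_of_ge hgm)
    have h_lt : (oddEdges (m * g)).ncard < N := hN ▸ h_diff ▸ Set.ncard_lt_ncard
      (Set.sdiff_subset.ssubset_of_not_subset fun h => (h he).2 hdg) (finite_oddEdges m)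
    exact (Subgroup.mul_mem_cancel_right _ (Subgroup.subset_closure hg)).1
      (ih _ h_lt _ (mul_mem hm (h_subset hg)) rfl)

theorem pairCycle_eq_mul (hσ : IsEncoding o χ σ) (ha : IsParity o a) {c : Cell n}
    (hc : IsOddCell o c) {p q r : Fin 3} (hpq : p ≠ q) (hr : r ≠ p ∧ r ≠ q) :
    pairCycle c r = pairCycle c p * pairCycle c q := by
  have h_ker := hσ.pairCycle_mem_cycleKernel ha hc
  refine eq_of_oddEdges_eq hσ.orderOf_map_I (h_ker r) (mul_mem (h_ker p) (h_ker q)) ?_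
  have h_dir (k : Fin 3) : k ≠ r ↔ k ≠ p ∧ k = q ∨ k ≠ q ∧ k = p := by
    revert p q r k; decide
  ext e
  by_cases he : e ∈ (graph n).edgeSet
  · obtain ⟨d, rfl⟩ := exists_dart_edge_eq he
    rw [oddEdges_mul, Set.mem_symmDiff]
    simp only [edge_mem_oddEdges_pairCycle]
    have := h_dir (dartDir d)
    tauto
  · exact iff_of_false (fun h => he (oddEdges_subset_edgeSet _ h)) fun h =>
      he (oddEdges_subset_edgeSet _ h)

theorem closure_range_kernelGen (hn : ∀ k, ∃ l, l ≠ k ∧ 0 < n l) (hσ : IsEncoding o χ σ)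
    (ha : IsParity o a) {p q : OddCell o → Fin 3} (hpq : ∀ c, p c ≠ q c) :
    Subgroup.closure (Set.range (kernelGen o p q)) = cycleKernel (graph n) σ := by
  have h_mem (i) : kernelGen o p q i ∈ Subgroup.closure (Set.range (kernelGen o p q)) :=
    Subgroup.subset_closure ⟨i, rfl⟩
  rw [← hσ.closure_basicCycles hn ha]
  refine le_antisymm (Subgroup.closure_mono ?_) ((Subgroup.closure_le _).2 ?_)
  · rintro _ ⟨f | c | c, rfl⟩
    exacts [.inl ⟨f.1, f.2, rfl⟩, .inr ⟨c.1, p c, c.2, rfl⟩, .inr ⟨c.1, q c, c.2, rfl⟩]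
  · rintro _ (⟨f, hf, rfl⟩ | ⟨c, r, hc, rfl⟩)
    · exact h_mem (.inl ⟨f, hf⟩)
    · have hp : pairCycle c (p ⟨c, hc⟩) ∈ _ := h_mem (.inr (.inl ⟨c, hc⟩))
      have hq : pairCycle c (q ⟨c, hc⟩) ∈ _ := h_mem (.inr (.inr ⟨c, hc⟩))
      by_cases hrp : r = p ⟨c, hc⟩
      · exact hrp ▸ hp
      by_cases hrq : r = q ⟨c, hc⟩
      · exact hrq ▸ hq
      · exact hσ.pairCycle_eq_mul ha hc (hpq _) ⟨hrp, hrq⟩ ▸ mul_mem hp hq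

end IsEncoding

end Cubic

/-! ### Independence of the generators -/

namespace Cubic

open MGroup

variable {n : Fin 3 → ℕ} {o : Orientation n} {a : Fin 3 → ℕ}

/-- The edge of a cell in direction `k` that starts at the vertex with the smallest coordinates. -/
def Cell.dart (c : Cell n) (k : Fin 3) : (graph n).Dart :=
  upDart (fun l => (c l).castSucc) k (c k).isLt

theorem Cell.dartDir_dart (c : Cell n) (k : Fin 3) : dartDir (c.dart k) = k := dartDir_upDart ..

theorem Cell.hasEdge_dart (c : Cell n) (k : Fin 3) : c.HasEdge (c.dart k).edge := by
  rw [hasEdge_edge_iff, dartDir_dart, dart, base_upDart]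
  exact ⟨rfl, fun l _ => .inl rfl⟩

namespace IsParity

variable {c c' : Cell n} {f : Face n} {d : (graph n).Dart}

theorem not_hasEdge_of_isIsolatedOddFace (ha : IsParity o a) (hf : IsIsolatedOddFace o f)
    (hc : IsOddCell o c) (hfd : f.HasEdge d.edge) : ¬ c.HasEdge d.edge := fun hcd =>
  hf.2.2 c hc (ha.isFaceOf_of_hasEdge hc hcd hf.1 hfd)

theorem eq_of_isOddCell (ha : IsParity o a) (hc : IsOddCell o c) (hc' : IsOddCell o c')
    (hcd : c.HasEdge d.edge) (hcd' : c'.HasEdge d.edge) : c = c' := by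
  obtain ⟨k, hk⟩ := exists_ne (dartDir d)
  obtain ⟨f, hfc, -, hfd⟩ := hcd.exists_isFaceOf hk
  exact ha.isOddCell_unique hc hc' hfc (ha.isFaceOf_of_hasEdge hc' hcd' (hc f hfc) hfd)

end IsParity

/-- An edge occurring an odd number of times in the cycle `kernelGen o p q i`, and an even number of
times in all others. For the pair of faces of an odd cell with one of the two chosen normal
directions, this is an edge in the other direction. -/
def dualDart (o : Orientation n) (p q : OddCell o → Fin 3) :
    IsolatedOddFace o ⊕ (OddCell o ⊕ OddCell o) → (graph n).Dart
  | .inl f => f.1.side 0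
  | .inr (.inl c) => c.1.dart (q c)
  | .inr (.inr c) => c.1.dart (p c)

theorem IsParity.dualDart_edge_mem_oddEdges_kernelGen (ha : IsParity o a) {p q : OddCell o → Fin 3}
    (hpq : ∀ c, p c ≠ q c) {i j : IsolatedOddFace o ⊕ (OddCell o ⊕ OddCell o)} :
    (dualDart o p q i).edge ∈ oddEdges (kernelGen o p q j) ↔ i = j := by
  have h_face (f : IsolatedOddFace o) := f.1.hasEdge_side 0
  have h_face_cell (f : IsolatedOddFace o) (c : OddCell o) {d : (graph n).Dart}
      (hf : f.1.HasEdge d.edge) : ¬ c.1.HasEdge d.edge :=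
    ha.not_hasEdge_of_isIsolatedOddFace f.2 c.2 hf
  have h_cell (c c' : OddCell o) (k : Fin 3) : c'.1.HasEdge (c.1.dart k).edge ↔ c = c' :=
    ⟨fun h => Subtype.ext (ha.eq_of_isOddCell c.2 c'.2 (c.1.hasEdge_dart k) h),
      fun h => h ▸ c.1.hasEdge_dart k⟩
  obtain f | c | c := i <;> obtain f' | c' | c' := j <;>
    simp only [dualDart, kernelGen, edge_mem_oddEdges_faceCycle, edge_mem_oddEdges_pairCycle,
      Cell.dartDir_dart, h_cell, Sum.inl.injEq, Sum.inr.injEq, reduceCtorEq, iff_false]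
  · exact ⟨fun h => Subtype.ext (ha.eq_of_isIsolatedOddFace f.2 f'.2.1 (h_face f) h),
      fun h => h ▸ h_face f⟩
  · exact fun h => h_face_cell f c' (h_face f) h.1
  · exact fun h => h_face_cell f c' (h_face f) h.1
  · exact fun h => h_face_cell f' c h (c.1.hasEdge_dart _)
  · exact and_iff_left_of_imp fun h => h ▸ (hpq c).symm
  · rintro ⟨rfl, h⟩
    exact h rfl
  · exact fun h => h_face_cell f' c h (c.1.hasEdge_dart _)
  · rintro ⟨rfl, h⟩
    exact h rfl
  · exact and_iff_left_of_imp fun h => h ▸ hpq c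

theorem IsParity.contentAt_dualDart_kernelGen (ha : IsParity o a) {p q : OddCell o → Fin 3}
    (hpq : ∀ c, p c ≠ q c) (i j : IsolatedOddFace o ⊕ (OddCell o ⊕ OddCell o)) :
    contentAt (graph n) (.inr (dualDart o p q i).edge) (kernelGen o p q j) = 1 ↔ i ≠ j := by
  rw [Ne, ← ha.dualDart_edge_mem_oddEdges_kernelGen hpq, mem_oddEdges, not_not]

end Cubic

theorem mainTheorem2_general (n : Fin 3 → ℕ) (hn : ∀ k, ∃ l, l ≠ k ∧ 0 < n l)
    (o : Cubic.Orientation n) (χ : Cubic.EdgeChoice o) :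
    ∃ σ : MGroup (Cubic.graph n) →* Cubic.Op o, Cubic.IsEncoding o χ σ ∧
      (∃ _ : Group.FG (MGroup.cycleKernel (Cubic.graph n) σ),
        Group.rank (MGroup.cycleKernel (Cubic.graph n) σ) =
          Fintype.card (Cubic.IsolatedOddFace o) + 2 * Fintype.card (Cubic.OddCell o)) ∧
      ∀ p q : Cubic.OddCell o → Fin 3, (∀ c, p c ≠ q c) →
        Subgroup.closure (Set.range (Cubic.kernelGen o p q)) =
            MGroup.cycleKernel (Cubic.graph n) σ ∧
          Function.Injective (Cubic.kernelGen o p q) ∧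
          ∀ i, Cubic.kernelGen o p q i ∉
            Subgroup.closure (Cubic.kernelGen o p q '' {i}ᶜ) := by
  obtain ⟨a, ha⟩ := Cubic.exists_isParity o
  obtain ⟨σ, hσ⟩ := Cubic.exists_isEncoding o χ hn
  have h_indep (p q : Cubic.OddCell o → Fin 3) (hpq : ∀ c, p c ≠ q c) :=
    notMem_closure_image_compl_of_dual (ha.contentAt_dualDart_kernelGen hpq)
  refine ⟨σ, hσ, ?_, fun p q hpq => ⟨hσ.closure_range_kernelGen hn ha hpq,
    injective_of_notMem_closure_image_compl (h_indep p q hpq), h_indep p q hpq⟩⟩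
  have h01 : ∀ _ : Cubic.OddCell o, (0 : Fin 3) ≠ 1 := fun _ => by decide
  rw [← hσ.closure_range_kernelGen hn ha h01]
  refine ⟨Group.closure_finite_fg _, ?_⟩
  rw [rank_closure_range_eq_card_of_dual (N := Multiplicative (ZMod 2)) (Nat.card_zmod 2)
    (ha.contentAt_dualDart_kernelGen h01), Fintype.card_sum, Fintype.card_sum, two_mul]

theorem mainTheorem2 (n : Fin 3 → ℕ) (hn : ∀ k, 0 < n k) (o : Cubic.Orientation n)
    (χ : Cubic.EdgeChoice o) :
    ∃ σ : MGroup (Cubic.graph n) →* Cubic.Op o, Cubic.IsEncoding o χ σ ∧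
      (∃ _ : Group.FG (MGroup.cycleKernel (Cubic.graph n) σ),
        Group.rank (MGroup.cycleKernel (Cubic.graph n) σ) =
          Fintype.card (Cubic.IsolatedOddFace o) + 2 * Fintype.card (Cubic.OddCell o)) ∧
      ∀ p q : Cubic.OddCell o → Fin 3, (∀ c, p c ≠ q c) →
        Subgroup.closure (Set.range (Cubic.kernelGen o p q)) =
            MGroup.cycleKernel (Cubic.graph n) σ ∧
          Function.Injective (Cubic.kernelGen o p q) ∧
          ∀ i, Cubic.kernelGen o p q i ∉
            Subgroup.closure (Cubic.kernelGen o p q '' {i}ᶜ) :=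
  mainTheorem2_general n (fun k => ⟨k + 1, by simp, hn _⟩) o χ
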